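/- Let $S$ be a closed, connected, oriented surface of genus at least $2$, and let $p\colon X\to S$ and $q\colon Y\to S$ be connected finite-degree abelian covers of $S$, i.e. finite-degree regular covering maps with connected total spaces whose groups of deck transformations are abelian. For a closed curve $\gamma\colon S^1\to S$ and a covering map $f\colon\Sigma\to S$, an elevation of $\gamma$ of degree $k\ge 1$ along $f$ is a closed curve $\delta\colon S^1\to\Sigma$ that covers $\gamma$ with degree $k$: $f(\delta(z))=\gamma(z^k)$ for all $z\in S^1$, and $z\mapsto(z^k,\delta(z))$ is injective (for simple $\gamma$ this says that $\delta$ is simple). Let $n_f(\gamma)$ denote the least positive integer $k$ such that $\gamma$ admits an elevation of degree $k$ along $f$. If $n_p(\gamma)=n_q(\gamma)$ for every simple closed curve $\gamma$ on $S$, then $p$ and $q$ are equivalent covers, i.e. there is a homeomorphism $h\colon X\to Y$ with $q\circ h=p$. -/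

import Mathlib

namespace SurfaceCover

/-- The point at parameter `t ∈ [0, 1]` of the `j`-th side of the `4g`-gon, realized as the closed
unit disc in `ℂ` whose boundary circle is divided into `4g` equal arcs (the sides, indexed
counterclockwise from `0`). -/
noncomputable def sidePoint (g j : ℕ) (t : ℝ) : Metric.closedBall (0 : ℂ) 1 :=
  ⟨(Circle.exp (2 * Real.pi * (j + t) / (4 * g)) : ℂ), by
    rw [mem_closedBall_zero_iff, Circle.norm_coe]⟩

/-- The side pairings of the `4g`-gon with boundary word
`a₁ b₁ a₁⁻¹ b₁⁻¹ ⋯ a_g b_g a_g⁻¹ b_g⁻¹`. -/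
inductive SidePairing (g : ℕ) : Metric.closedBall (0 : ℂ) 1 → Metric.closedBall (0 : ℂ) 1 → Prop
  | a (i : Fin g) (t : ℝ) (ht : t ∈ Set.Icc (0 : ℝ) 1) :
      SidePairing g (sidePoint g (4 * i) t) (sidePoint g (4 * i + 2) (1 - t))
  | b (i : Fin g) (t : ℝ) (ht : t ∈ Set.Icc (0 : ℝ) 1) :
      SidePairing g (sidePoint g (4 * i + 1) t) (sidePoint g (4 * i + 3) (1 - t))

/-- The standard closed oriented surface of genus `g ≥ 1`: the `4g`-gon with its sides identified
in pairs according to the word `[a₁, b₁] ⋯ [a_g, b_g]`, with the quotient topology. -/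
abbrev StandardSurface (g : ℕ) : Type := Quot (SidePairing g)

/-- `S` is a closed connected orientable surface of genus `g` (for `g ≥ 1`). -/
def IsClosedOrientableSurface (g : ℕ) (S : Type*) [TopologicalSpace S] : Prop :=
  Nonempty (S ≃ₜ StandardSurface g)

/-- The group of deck transformations of `p`. -/
def deckGroup {X S : Type*} [TopologicalSpace X] (p : X → S) : Subgroup (X ≃ₜ X) where
  carrier := {h | ∀ x, p (h x) = p x}
  one_mem' := fun _ => rfl
  mul_mem' := fun {h k} hh hk x => (hh (k x)).trans (hk x)
  inv_mem' := fun {h} hh x => by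
    have h1 := hh (h⁻¹ x)
    have h2 : h (h⁻¹ x) = x := h.apply_symm_apply x
    rw [h2] at h1
    exact h1.symm

/-- A connected finite-degree abelian cover `p : X → S`: a covering map with connected total space
and finite fibers which is regular, with abelian group of deck transformations. -/
structure IsFiniteAbelianCover {X S : Type*} [TopologicalSpace X] [TopologicalSpace S]
    (p : X → S) : Prop where
  connected : ConnectedSpace X
  isCoveringMap : IsCoveringMap p
  surjective : Function.Surjective p
  finite_fiber : ∀ s, (p ⁻¹' {s}).Finite
  regular : ∀ x y, p x = p y → ∃ h ∈ deckGroup p, h x = y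
  abelian : ∀ h ∈ deckGroup p, ∀ k ∈ deckGroup p, h * k = k * h

/-- The closed curve `δ` is an elevation of degree `k` of the closed curve `γ` along `p`: it
projects to `γ` traversed `k ≥ 1` times, and it covers `γ` exactly `k` times, i.e. `z ↦ (z ^ k, δ z)`
embeds the circle into the pullback of `p` along `γ`. (When `γ` is simple, the last condition says
that `δ` is injective.) -/
structure IsElevation {X S : Type*} [TopologicalSpace X] [TopologicalSpace S]
    (p : X → S) (γ : C(Circle, S)) (k : ℕ) (δ : C(Circle, X)) : Prop where
  pos : 0 < k
  proj : ∀ z, p (δ z) = γ (z ^ k)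
  injective : Function.Injective fun z => (z ^ k, δ z)

/-- The least degree of an elevation of the closed curve `γ` along `p`. -/
noncomputable def minElevationDegree {X S : Type*} [TopologicalSpace X] [TopologicalSpace S]
    (p : X → S) (γ : C(Circle, S)) : ℕ :=
  sInf {k | ∃ δ : C(Circle, X), IsElevation p γ k δ}

/-- Equivalence of covers of `S`: a homeomorphism of the total spaces over `S`. -/
def AreEquivalentCovers {X Y S : Type*} [TopologicalSpace X] [TopologicalSpace Y]
    (p : X → S) (q : Y → S) : Prop :=
  ∃ h : X ≃ₜ Y, ∀ x, q (h x) = p x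

end SurfaceCover

/-! Model `S` as the `4g`-gon with paired sides. An abelian cover is a torsor for its deck group
`A`, and the polygon lifts to it as a map `P`. Across each pair of sides the lift jumps by a deck
transformation, which gives periods `a i`, `b i`. As `A` is commutative, the periods define a
homomorphism `ℤ^{2g} → A`, in effect the map from the first homology of `S`. It is onto because the
total space is connected, and its kernel determines the cover
(`areEquivalentCovers_of_periodProd_eq_one_iff`). It remains to see that elevation degrees decide
which vectors `(m, n)` lie in the kernel.

For a multiple `d` of the first basis vector this is direct. The least elevation degree of a curve
is the order of its monodromy (`IsTorsorCover.minElevationDegree_eq_orderOf`), the simple curve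
crossing the first pair of sides has monodromy `(a 0)⁻¹`, and `(a 0) ^ d = 1` iff that order divides
`d`.

For other vectors, change the covers instead of the curve. A homeomorphism `f` of the surface
permutes simple closed curves, so the hypothesis passes from `p`, `q` to `f⁻¹ ∘ p`, `f⁻¹ ∘ q`. If
`f` is a Dehn twist, an explicit twisted lift of the polygon has periods changed by a transvection.
Hence the set of vectors for which the claim holds for all pairs of covers at once is stable under
these transvections, and a Euclidean algorithm (`transvection_induction`) reaches every vector from
a multiple of the first basis vector. The curves needed cross `a i`, or `b i`, or both `b i` and `b
(i + 1)`.

The twists are given by formulas on chords of the disc, for maps into any space with a commutative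
group action. With `A` acting on `X` they produce the lifts; with the trivial group acting on the
surface they produce the twist itself. -/

namespace SurfaceCover

/-! ### Torsor covers; elevation degree as order of the monodromy -/

/-- The group `A` acts by deck transformations of the covering map `p`, freely and transitively on
each fiber. -/
structure IsTorsorCover (A : Type*) {X S : Type*} [TopologicalSpace X] [TopologicalSpace S]
    [CommGroup A] [MulAction A X] (p : X → S) : Prop where
  isCoveringMap : IsCoveringMap p
  surjective : Function.Surjective p
  map_smul : ∀ (a : A) (x : X), p (a • x) = p x
  exists_smul : ∀ x y : X, p x = p y → ∃ a : A, a • x = y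
  free : ∀ (a : A) (x : X), a • x = x → a = 1

theorem exists_circleMap_of_periodic {Z : Type*} [TopologicalSpace Z] {f : ℝ → Z}
    (hf : Continuous f) (hper : Function.Periodic f (2 * Real.pi)) :
    ∃ γ : C(Circle, Z), ∀ t, γ (Circle.exp t) = f t := by
  have hresp : ∀ s t, Circle.exp s = Circle.exp t → f s = f t := by
    intro s t hst
    obtain ⟨m, rfl⟩ := Circle.exp_eq_exp.1 hst
    exact hper.int_mul m t
  have hγ : ∀ t, f (Circle.exp_surjective (Circle.exp t)).choose = f t := fun t =>
    hresp _ _ (Circle.exp_surjective (Circle.exp t)).choose_spec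
  refine ⟨⟨fun z => f (Circle.exp_surjective z).choose, ?_⟩, hγ⟩
  rw [(Circle.isCoveringMap_exp.isQuotientMap Circle.exp_surjective).continuous_iff]
  exact hf.congr fun t => (hγ t).symm

section Torsor

variable {A X S : Type*} [TopologicalSpace X] [TopologicalSpace S] [CommGroup A] [MulAction A X]
  {p : X → S}

theorem IsTorsorCover.eq_of_smul_eq (hp : IsTorsorCover A p) {a b : A} {x : X}
    (h : a • x = b • x) : a = b := by
  have h1 : (b⁻¹ * a) • x = x := by rw [mul_smul, h, inv_smul_smul]
  exact (inv_mul_eq_one.1 (hp.free _ _ h1)).symm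

theorem IsTorsorCover.homeomorph_comp {T : Type*} [TopologicalSpace T] (hp : IsTorsorCover A p)
    (f : S ≃ₜ T) : IsTorsorCover A (f ∘ p) where
  isCoveringMap := hp.isCoveringMap.homeomorph_comp f
  surjective := f.surjective.comp hp.surjective
  map_smul a x := congrArg f (hp.map_smul a x)
  exists_smul x y h := hp.exists_smul x y (f.injective h)
  free := hp.free

variable [ContinuousConstSMul A X]

/-- The least degree of an elevation is the order of the monodromy. -/
theorem IsTorsorCover.minElevationDegree_eq_orderOf (hp : IsTorsorCover A p) (γ : C(Circle, S))
    {Γ : ℝ → X} (hΓ : Continuous Γ) (hlift : ∀ t, p (Γ t) = γ (Circle.exp t)) {a : A}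
    (ha : Γ (2 * Real.pi) = a • Γ 0) : minElevationDegree p γ = orderOf a := by
  -- Both sides lift the same path and agree at `0`, so unique lifting applies.
  have hshift : ∀ t, Γ (t + 2 * Real.pi) = a • Γ t := by
    have := hp.isCoveringMap.eq_of_comp_eq (g₁ := fun t => Γ (t + 2 * Real.pi))
      (g₂ := fun t => a • Γ t) (by fun_prop) (by fun_prop)
      (by
        funext t
        simp only [Function.comp_apply, hlift, hp.map_smul, Circle.exp_add_two_pi]) 0
      (by simpa using ha)
    exact fun t => congrFun this t
  have hshiftn : ∀ (n : ℕ) t, Γ (t + n * (2 * Real.pi)) = a ^ n • Γ t := by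
    intro n
    induction n with
    | zero => simp
    | succ n ih =>
      intro t
      have : t + ((n + 1 : ℕ) : ℝ) * (2 * Real.pi) = (t + n * (2 * Real.pi)) + 2 * Real.pi := by
        push_cast; ring
      rw [this, hshift, ih, pow_succ', mul_smul]
  have hshiftz : ∀ (n : ℤ) t, Γ (t + n * (2 * Real.pi)) = a ^ n • Γ t := by
    intro n t
    obtain ⟨m, rfl | rfl⟩ := n.eq_nat_or_neg
    · simpa using hshiftn m t
    · have := hshiftn m (t + ((-(m : ℤ) : ℤ) : ℝ) * (2 * Real.pi))
      have e : t + ((-(m : ℤ) : ℤ) : ℝ) * (2 * Real.pi) + m * (2 * Real.pi) = t := by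
        push_cast; ring
      rw [e] at this
      rw [this, zpow_neg, zpow_natCast, inv_smul_smul]
  -- Unrolled at speed `1 / k`, an elevation is a translate of `Γ`; that it closes up after `k`
  -- turns forces `a ^ k = 1`.
  have hdvd : ∀ k, (∃ δ : C(Circle, X), IsElevation p γ k δ) → orderOf a ∣ k := by
    rintro k ⟨δ, hδ⟩
    have hk : (k : ℝ) ≠ 0 := Nat.cast_ne_zero.2 hδ.pos.ne'
    obtain ⟨b, hb⟩ := hp.exists_smul (Γ 0) (δ (Circle.exp 0)) (by
      rw [hlift, hδ.proj]; simp)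
    have := hp.isCoveringMap.eq_of_comp_eq (g₁ := fun t => b • Γ t)
      (g₂ := fun t : ℝ => δ (Circle.exp (t / k))) (by fun_prop) (by fun_prop)
      (by
        funext t
        simp only [Function.comp_apply, hlift, hp.map_smul, hδ.proj]
        congr 1
        rw [← Circle.exp_nsmul, nsmul_eq_mul, mul_div_cancel₀ _ hk]) 0
      (by simpa using hb)
    have h1 := congrFun this (0 + k * (2 * Real.pi))
    simp only [zero_add] at h1
    rw [mul_div_cancel_left₀ _ hk, Circle.exp_two_pi, ← Circle.exp_zero, ← hb] at h1
    have h2 := hshiftn k 0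
    rw [zero_add, smul_left_cancel b h1] at h2
    exact orderOf_dvd_of_pow_eq_one (hp.free _ _ h2.symm)
  have hmem : 0 < orderOf a → ∃ δ : C(Circle, X), IsElevation p γ (orderOf a) δ := by
    intro hpos
    set k := orderOf a with hk
    have hk0 : (k : ℝ) ≠ 0 := Nat.cast_ne_zero.2 hpos.ne'
    obtain ⟨δ, hδ⟩ := exists_circleMap_of_periodic (f := fun t => Γ (k * t)) (by fun_prop) (by
      intro t
      simp only [mul_add, hshiftn, hk, pow_orderOf_eq_one, one_smul])
    refine ⟨δ, hpos, ?_, ?_⟩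
    · intro z
      obtain ⟨t, rfl⟩ := Circle.exp_surjective z
      simp only [hδ, hlift]
      rw [← Circle.exp_nsmul, nsmul_eq_mul]
    · intro z w hzw
      obtain ⟨s, rfl⟩ := Circle.exp_surjective z
      obtain ⟨t, rfl⟩ := Circle.exp_surjective w
      simp only [hδ, Prod.mk.injEq] at hzw
      obtain ⟨h1, h2⟩ := hzw
      rw [← Circle.exp_nsmul, ← Circle.exp_nsmul, nsmul_eq_mul, nsmul_eq_mul] at h1
      obtain ⟨m, hm⟩ := Circle.exp_eq_exp.1 h1
      rw [hm, hshiftz] at h2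
      have h3 := hp.free _ _ h2
      obtain ⟨j, rfl⟩ := orderOf_dvd_iff_zpow_eq_one.2 h3
      rw [Circle.exp_eq_exp]
      refine ⟨j, ?_⟩
      rw [← hk] at hm
      apply mul_left_cancel₀ hk0
      rw [hm]; push_cast; ring
  unfold minElevationDegree
  -- For `a` of infinite order there is no elevation, and `sInf ∅ = 0` matches `orderOf a = 0`.
  rcases Nat.eq_zero_or_pos (orderOf a) with h0 | hpos
  · rw [h0, Nat.sInf_eq_zero]
    right
    ext k
    simp only [Set.mem_ofPred_eq, Set.mem_empty_iff_false, iff_false]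
    intro hk
    have := hdvd k hk
    rw [h0, zero_dvd_iff] at this
    obtain ⟨δ, hδ⟩ := hk
    exact hδ.pos.ne' this
  · apply le_antisymm
    · exact Nat.sInf_le (hmem hpos)
    · refine le_csInf ⟨_, hmem hpos⟩ ?_
      intro k hk
      obtain ⟨δ, hδ⟩ := id hk
      exact Nat.le_of_dvd hδ.pos (hdvd k hk)

end Torsor

/-! ### Lifting the polygon -/

/-- Continuous maps from the closed unit disc lift along covering maps. -/
theorem exists_lift_closedBall {X S : Type*} [TopologicalSpace X] [TopologicalSpace S] {p : X → S}
    (hp : IsCoveringMap p) (hsurj : Function.Surjective p) {f : Metric.closedBall (0 : ℂ) 1 → S}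
    (hf : Continuous f) : ∃ P : Metric.closedBall (0 : ℂ) 1 → X, Continuous P ∧ ∀ z, p (P z) = f z := by
  -- The radial contraction `f (s z)` is a homotopy from a constant map to `f`; lift it from a
  -- constant.
  let H : C(unitInterval × Metric.closedBall (0 : ℂ) 1, S) :=
    ⟨fun u => f ⟨(u.1 : ℝ) • (u.2 : ℂ), by
        have h1 := u.2.2
        rw [mem_closedBall_zero_iff] at h1 ⊢
        rw [norm_smul, Real.norm_of_nonneg u.1.2.1]
        exact mul_le_one₀ u.1.2.2 (norm_nonneg _) h1⟩, by fun_prop⟩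
  obtain ⟨x, hx⟩ := hsurj (f ⟨0, by simp⟩)
  let L := hp.liftHomotopy H (ContinuousMap.const _ x) (by
    intro a
    change f _ = _
    simp only [ContinuousMap.const_apply, hx]
    congr 2
    simp)
  refine ⟨fun z => L (1, z), by fun_prop, fun z => ?_⟩
  have := congrFun (hp.liftHomotopy_lifts H (ContinuousMap.const _ x) (by
    intro a
    change f _ = _
    simp only [ContinuousMap.const_apply, hx]
    congr 2
    simp)) (1, z)
  refine this.trans ?_
  change f _ = _
  congr 1
  ext
  simp

/-- The closed unit disc. -/
abbrev Disc : Type := Metric.closedBall (0 : ℂ) 1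

/-- Regularity gives transitivity on fibers; freeness is uniqueness of lifts on the connected space
`X`. -/
theorem IsFiniteAbelianCover.exists_isTorsorCover.{u, v} {X : Type u} {S : Type v} [TopologicalSpace X]
    [TopologicalSpace S] {p : X → S} (hp : IsFiniteAbelianCover p) :
    ∃ (A : Type u) (_ : CommGroup A) (_ : MulAction A X) (_ : ContinuousConstSMul A X),
      IsTorsorCover A p := by
  have := hp.connected
  let _ : CommGroup (deckGroup p) :=
    { (inferInstance : Group (deckGroup p)) with
      mul_comm := fun h k => Subtype.ext (hp.abelian h h.2 k k.2) }
  let _ : MulAction (deckGroup p) X :=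
    { smul := fun h x => h.1 x
      one_smul := fun _ => rfl
      mul_smul := fun _ _ _ => rfl }
  refine ⟨deckGroup p, inferInstance, inferInstance, ⟨fun h => h.1.continuous⟩,
    hp.isCoveringMap, hp.surjective, fun h x => h.2 x, ?_, ?_⟩
  · intro x y hxy
    obtain ⟨h, hh, hx⟩ := hp.regular x y hxy
    exact ⟨⟨h, hh⟩, hx⟩
  · intro h x hx
    have := hp.isCoveringMap.eq_of_comp_eq (g₁ := h.1) (g₂ := id) h.1.continuous continuous_id
      (funext fun y => h.2 y) x hx
    exact Subtype.ext (Homeomorph.ext fun y => congrFun this y)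

/-- `P` is a map on the `4g`-gon which respects the side pairings up to the periods
`a i`, `b i ∈ A`. -/
structure IsPeriodLift {A X : Type*} [TopologicalSpace X] [CommGroup A] [MulAction A X] {g : ℕ}
    (P : Disc → X) (a b : Fin g → A) : Prop where
  continuous : Continuous P
  a_rel : ∀ (i : Fin g), ∀ t ∈ Set.Icc (0 : ℝ) 1,
    P (sidePoint g (4 * i) t) = a i • P (sidePoint g (4 * i + 2) (1 - t))
  b_rel : ∀ (i : Fin g), ∀ t ∈ Set.Icc (0 : ℝ) 1,
    P (sidePoint g (4 * i + 1) t) = b i • P (sidePoint g (4 * i + 3) (1 - t))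

/-- The element with given coordinates with respect to the periods `a`, `b`. -/
def periodProd {A : Type*} [CommGroup A] {g : ℕ} (a b : Fin g → A) (m n : Fin g → ℤ) : A :=
  ∏ i, (a i ^ m i * b i ^ n i)

@[fun_prop]
theorem continuous_sidePoint (g j : ℕ) : Continuous (sidePoint g j) := by
  unfold sidePoint
  fun_prop

/-! ### Periods, and reconstruction of a cover from them -/

section Lift

variable {A X : Type*} [TopologicalSpace X] [CommGroup A] [MulAction A X]
  [ContinuousConstSMul A X] {g : ℕ} {p : X → StandardSurface g}

/-- Along two paired sides the lift gives two lifts of one path in the surface. A deck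
transformation matching them at one end matches them throughout, by unique lifting over the
interval. -/
theorem IsTorsorCover.exists_isPeriodLift (hp : IsTorsorCover A p) :
    ∃ (P : Disc → X) (a b : Fin g → A), IsPeriodLift P a b ∧ ∀ z, p (P z) = Quot.mk _ z := by
  obtain ⟨P, hP, hpP⟩ := exists_lift_closedBall hp.isCoveringMap hp.surjective
    (f := fun z => (Quot.mk _ z : StandardSurface g)) continuous_quot_mk
  have key : ∀ j k : ℕ, (∀ t ∈ Set.Icc (0 : ℝ) 1,
      (Quot.mk _ (sidePoint g j t) : StandardSurface g) = Quot.mk _ (sidePoint g k (1 - t))) →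
      ∃ c : A, ∀ t ∈ Set.Icc (0 : ℝ) 1, P (sidePoint g j t) = c • P (sidePoint g k (1 - t)) := by
    intro j k hjk
    have h0 : (0 : ℝ) ∈ Set.Icc (0 : ℝ) 1 := by simp
    obtain ⟨c, hc⟩ := hp.exists_smul (P (sidePoint g k (1 - 0))) (P (sidePoint g j 0)) (by
      rw [hpP, hpP, hjk 0 h0])
    refine ⟨c, hp.isCoveringMap.eqOn_of_comp_eqOn (g₁ := fun t => P (sidePoint g j t))
      (g₂ := fun t => c • P (sidePoint g k (1 - t))) isPreconnected_Icc
      (Continuous.continuousOn (by fun_prop)) (Continuous.continuousOn (by fun_prop)) ?_ h0 hc.symm⟩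
    intro t ht
    simp only [Function.comp_apply, hp.map_smul, hpP, hjk t ht]
  choose a ha using fun i : Fin g => key (4 * i) (4 * i + 2) fun t ht =>
    Quot.sound (SidePairing.a i t ht)
  choose b hb using fun i : Fin g => key (4 * i + 1) (4 * i + 3) fun t ht =>
    Quot.sound (SidePairing.b i t ht)
  exact ⟨P, a, b, ⟨hP, ha, hb⟩, hpP⟩

/-- Maps out of the total space of a cover of the standard surface are given by families of maps
on translates of the polygon which are compatible with the side pairings. -/
theorem IsTorsorCover.exists_descend (hp : IsTorsorCover A p) {P : Disc → X} {a b : Fin g → A}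
    (hP : IsPeriodLift P a b) (hpP : ∀ z, p (P z) = Quot.mk _ z) {Z : Type*} [TopologicalSpace Z]
    (u : A → Disc → Z) (hu : ∀ c, Continuous (u c))
    (hua : ∀ c (i : Fin g), ∀ t ∈ Set.Icc (0 : ℝ) 1,
      u c (sidePoint g (4 * i) t) = u (c * a i) (sidePoint g (4 * i + 2) (1 - t)))
    (hub : ∀ c (i : Fin g), ∀ t ∈ Set.Icc (0 : ℝ) 1,
      u c (sidePoint g (4 * i + 1) t) = u (c * b i) (sidePoint g (4 * i + 3) (1 - t))) :
    ∃ h : X → Z, Continuous h ∧ ∀ c z, h (c • P z) = u c z := by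
  have hex : ∀ x, ∃ (c : A) (z : Disc), c • P z = x := by
    intro x
    obtain ⟨z, hz⟩ := Quot.exists_rep (p x)
    obtain ⟨c, hc⟩ := hp.exists_smul (P z) x (by rw [hpP, hz])
    exact ⟨c, z, hc⟩
  -- An identification in the polygon carries each translate to a definite neighbouring translate,
  -- with the same value of `u`; freeness is needed only to reverse it.
  have hgen : ∀ z z', Relation.EqvGen (SidePairing g) z z' →
      ∀ c, ∃ c', c • P z = c' • P z' ∧ u c z = u c' z' := by
    intro z z' h
    induction h with
    | rel z z' h =>
      intro c
      cases h with
      | a i t ht => exact ⟨c * a i, by rw [hP.a_rel i t ht, mul_smul], hua c i t ht⟩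
      | b i t ht => exact ⟨c * b i, by rw [hP.b_rel i t ht, mul_smul], hub c i t ht⟩
    | refl z => exact fun c => ⟨c, rfl, rfl⟩
    | symm z z' _ ih =>
      intro c
      obtain ⟨d, hd, -⟩ := ih 1
      obtain ⟨e, he, he'⟩ := ih (c * d⁻¹)
      have : e = c := by
        apply hp.eq_of_smul_eq (x := P z')
        rw [← he, mul_smul, inv_smul_eq_iff.2 (by simpa using hd)]
      exact ⟨c * d⁻¹, by rw [he, this], by rw [he', this]⟩
    | trans z z' z'' _ _ ih ih' =>
      intro c
      obtain ⟨d, hd, hd'⟩ := ih c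
      obtain ⟨e, he, he'⟩ := ih' d
      exact ⟨e, hd.trans he, hd'.trans he'⟩
  have hwd : ∀ c c' z z', c • P z = c' • P z' → u c z = u c' z' := by
    intro c c' z z' h
    have h1 : (Quot.mk _ z : StandardSurface g) = Quot.mk _ z' := by
      rw [← hpP, ← hpP, ← hp.map_smul c, h, hp.map_smul]
    obtain ⟨d, hd, hd'⟩ := hgen z z' (Quot.eqvGen_exact h1) c
    rw [hd', hp.eq_of_smul_eq (hd.symm.trans h)]
  choose C hC using hex
  choose W hW using hC
  have hform : ∀ c z, u (C (c • P z)) (W (c • P z)) = u c z := fun c z => hwd _ _ _ _ (hW _)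
  refine ⟨fun x => u (C x) (W x), ?_, hform⟩
  refine continuous_def.2 fun V hV => isOpen_iff_mem_nhds.2 fun x hx => ?_
  obtain ⟨e, hxe, he⟩ := hp.isCoveringMap.isLocalHomeomorph x
  set U : Set X := (fun x => u (C x) (W x)) ⁻¹' V with hU
  -- Openness is tested on the polygon, which carries the quotient topology: near `z` the translate
  -- `c • P` through `y` stays in `U ∩ e.source`.
  have hopen : IsOpen (p '' (U ∩ e.source)) := by
    rw [← isQuotientMap_quot_mk.isOpen_preimage]
    refine isOpen_iff_mem_nhds.2 fun z hz => ?_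
    obtain ⟨y, ⟨hyU, hye⟩, hy⟩ := hz
    obtain ⟨c, hc⟩ := hp.exists_smul (P z) y (by rw [hpP, hy])
    have h1 : (fun w => c • P w) ⁻¹' e.source ∈ nhds z := by
      apply ((hP.continuous.const_smul c).isOpen_preimage _ e.open_source).mem_nhds
      simpa [hc] using hye
    have h2 : u c ⁻¹' V ∈ nhds z := by
      apply ((hu c).isOpen_preimage _ hV).mem_nhds
      have : u (C y) (W y) ∈ V := hyU
      rwa [← hc, hform] at this
    filter_upwards [h1, h2] with w hw1 hw2
    refine ⟨c • P w, ⟨?_, hw1⟩, by rw [hp.map_smul, hpP]⟩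
    change u _ _ ∈ V
    rw [hform]; exact hw2
  have hnhds : e.source ∩ p ⁻¹' (p '' (U ∩ e.source)) ∈ nhds x :=
    (e.open_source.inter (hopen.preimage hp.isCoveringMap.continuous)).mem_nhds
      ⟨hxe, ⟨x, ⟨hx, hxe⟩, rfl⟩⟩
  filter_upwards [hnhds]
  rintro y ⟨hy, y', ⟨hy'U, hy'⟩, hyy'⟩
  rw [he] at hyy'
  rwa [e.injOn hy' hy hyy'] at hy'U

theorem periodProd_mul (a b : Fin g → A) (m n m' n' : Fin g → ℤ) :
    periodProd a b (m + m') (n + n') = periodProd a b m n * periodProd a b m' n' := by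
  unfold periodProd
  rw [← Finset.prod_mul_distrib]
  refine Finset.prod_congr rfl fun i _ => ?_
  simp only [Pi.add_apply, zpow_add]
  exact mul_mul_mul_comm _ _ _ _

/-- `periodProd` as a group homomorphism. -/
def periodHom (a b : Fin g → A) : Multiplicative ((Fin g → ℤ) × (Fin g → ℤ)) →* A where
  toFun v := periodProd a b v.toAdd.1 v.toAdd.2
  map_one' := by simp [periodProd]
  map_mul' v w := periodProd_mul a b _ _ _ _

theorem periodHom_single_left (a b : Fin g → A) (i : Fin g) :
    periodHom a b (Multiplicative.ofAdd (Pi.single i 1, 0)) = a i := by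
  change periodProd _ _ _ _ = _
  simp only [periodProd, toAdd_ofAdd, Pi.zero_apply, zpow_zero, mul_one]
  rw [Finset.prod_eq_single i] <;> simp +contextual

theorem periodHom_single_right (a b : Fin g → A) (i : Fin g) :
    periodHom a b (Multiplicative.ofAdd (0, Pi.single i 1)) = b i := by
  change periodProd _ _ _ _ = _
  simp only [periodProd, toAdd_ofAdd, Pi.zero_apply, zpow_zero, one_mul]
  rw [Finset.prod_eq_single i] <;> simp +contextual

/-- Crossing a side changes the translate by a period, so the coset of the translate modulo the
periods is a continuous map from `X` to a discrete space, hence constant. -/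
theorem IsTorsorCover.periodHom_surjective [ConnectedSpace X] (hp : IsTorsorCover A p)
    {P : Disc → X} {a b : Fin g → A}
    (hP : IsPeriodLift P a b) (hpP : ∀ z, p (P z) = Quot.mk _ z) :
    Function.Surjective (periodHom a b) := by
  let _ : TopologicalSpace (A ⧸ (periodHom a b).range) := ⊥
  have : DiscreteTopology (A ⧸ (periodHom a b).range) := ⟨rfl⟩
  obtain ⟨h, hc, hh⟩ := hp.exists_descend hP hpP
    (fun c _ => (QuotientGroup.mk c : A ⧸ (periodHom a b).range)) (fun _ => continuous_const)
    (fun c i t _ => by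
      rw [QuotientGroup.eq, inv_mul_cancel_left]
      exact ⟨_, periodHom_single_left a b i⟩)
    (fun c i t _ => by
      rw [QuotientGroup.eq, inv_mul_cancel_left]
      exact ⟨_, periodHom_single_right a b i⟩)
  intro c
  have z : Disc := ⟨0, by simp⟩
  have := PreconnectedSpace.constant inferInstance hc (x := (1 : A) • P z) (y := c • P z)
  rw [hh, hh, QuotientGroup.eq, inv_one, one_mul] at this
  exact this

/-- Equal kernels identify `A` with `B` so that the periods correspond; then `c • P z ↦ ψ c • Q z`
and its analogue for `ψ.symm` descend to mutually inverse maps. -/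
theorem areEquivalentCovers_of_periodProd_eq_one_iff {B Y : Type*} [TopologicalSpace Y]
    [CommGroup B] [MulAction B Y] [ContinuousConstSMul B Y] {q : Y → StandardSurface g}
    [ConnectedSpace X] [ConnectedSpace Y] (hp : IsTorsorCover A p) (hq : IsTorsorCover B q)
    {P : Disc → X} {a b : Fin g → A} (hP : IsPeriodLift P a b) (hpP : ∀ z, p (P z) = Quot.mk _ z)
    {Q : Disc → Y} {a' b' : Fin g → B} (hQ : IsPeriodLift Q a' b')
    (hqQ : ∀ z, q (Q z) = Quot.mk _ z)
    (h : ∀ m n, periodProd a b m n = 1 ↔ periodProd a' b' m n = 1) : AreEquivalentCovers p q := by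
  have hs := hp.periodHom_surjective hP hpP
  have hs' := hq.periodHom_surjective hQ hqQ
  have hker : (periodHom a b).ker = (periodHom a' b').ker := by
    ext v
    exact h _ _
  let ψ : A ≃* B := (QuotientGroup.quotientKerEquivOfSurjective _ hs).symm.trans
    ((QuotientGroup.quotientMulEquivOfEq hker).trans
      (QuotientGroup.quotientKerEquivOfSurjective _ hs'))
  have hψ : ∀ v, ψ (periodHom a b v) = periodHom a' b' v := by
    intro v
    have : (QuotientGroup.quotientKerEquivOfSurjective _ hs).symm (periodHom a b v) =
        QuotientGroup.mk v := by
      rw [MulEquiv.symm_apply_eq]; rfl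
    simp only [ψ, MulEquiv.trans_apply, this]
    rfl
  have hψa : ∀ i, ψ (a i) = a' i := fun i => by
    rw [← periodHom_single_left a b i, hψ, periodHom_single_left]
  have hψb : ∀ i, ψ (b i) = b' i := fun i => by
    rw [← periodHom_single_right a b i, hψ, periodHom_single_right]
  obtain ⟨k, hk, hk'⟩ := hp.exists_descend hP hpP (fun c z => ψ c • Q z)
    (fun c => hQ.continuous.const_smul _)
    (fun c i t ht => by rw [map_mul, mul_smul, hψa, hQ.a_rel i t ht])
    (fun c i t ht => by rw [map_mul, mul_smul, hψb, hQ.b_rel i t ht])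
  obtain ⟨l, hl, hl'⟩ := hq.exists_descend hQ hqQ (fun c z => ψ.symm c • P z)
    (fun c => hP.continuous.const_smul _)
    (fun c i t ht => by
      rw [map_mul, mul_smul, ← hψa, ψ.symm_apply_apply, hP.a_rel i t ht])
    (fun c i t ht => by
      rw [map_mul, mul_smul, ← hψb, ψ.symm_apply_apply, hP.b_rel i t ht])
  have hex : ∀ x, ∃ c : A, ∃ z, c • P z = x := by
    intro x
    obtain ⟨z, hz⟩ := Quot.exists_rep (p x)
    obtain ⟨c, hc⟩ := hp.exists_smul (P z) x (by rw [hpP, hz])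
    exact ⟨c, z, hc⟩
  have hex' : ∀ y, ∃ c : B, ∃ z, c • Q z = y := by
    intro y
    obtain ⟨z, hz⟩ := Quot.exists_rep (q y)
    obtain ⟨c, hc⟩ := hq.exists_smul (Q z) y (by rw [hqQ, hz])
    exact ⟨c, z, hc⟩
  refine ⟨⟨⟨k, l, ?_, ?_⟩, hk, hl⟩, ?_⟩
  · intro x
    obtain ⟨c, z, rfl⟩ := hex x
    rw [hk', hl', ψ.symm_apply_apply]
  · intro y
    obtain ⟨c, z, rfl⟩ := hex' y
    rw [hl', hk', ψ.apply_symm_apply]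
  · intro x
    obtain ⟨c, z, rfl⟩ := hex x
    change q (k _) = _
    rw [hk', hq.map_smul, hp.map_smul, hpP, hqQ]

end Lift

/-! ### Euclidean algorithm by transvections -/

section Euclid

/-- A property of pairs of integers which is invariant under transvections depends only on the
greatest common divisor. -/
theorem transvection_invariant_iff_gcd {R : ℤ → ℤ → Prop}
    (h1 : ∀ k x y, R x y → R (x + k * y) y) (h2 : ∀ k x y, R x y → R x (y + k * x)) (x y : ℤ) :
    R x y ↔ R (Int.gcd x y) 0 := by
  have h1' : ∀ k x y, R x y ↔ R (x + k * y) y := fun k x y =>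
    ⟨h1 k x y, fun h => by simpa using h1 (-k) _ _ h⟩
  have h2' : ∀ k x y, R x y ↔ R x (y + k * x) := fun k x y =>
    ⟨h2 k x y, fun h => by simpa using h2 (-k) _ _ h⟩
  -- The quarter turn is a product of three transvections.
  have hrot : ∀ x y, R x y ↔ R y (-x) := fun x y => by
    rw [h1' 1 x y, h2' (-1) (x + 1 * y) y, h1' 1 (x + 1 * y)]
    ring_nf
  induction hn : y.natAbs using Nat.strong_induction_on generalizing x y with
  | _ n ih =>
    rcases eq_or_ne y 0 with rfl | hy
    · rw [Int.gcd_zero_right]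
      rcases Int.natAbs_eq x with h | h
      · rw [← h]
      · rw [hrot, hrot, neg_zero]
        have : -x = x.natAbs := by omega
        rw [this]
    · have e : x + (-(x / y)) * y = x % y := by
        have := Int.emod_add_mul_ediv x y
        linarith
      have hlt : (-(x % y)).natAbs < n := by
        have h3 := Int.emod_nonneg x hy
        have h4 := Int.emod_lt_abs x hy
        have h5 := Int.natCast_natAbs y
        omega
      have h6 : R y (-(x % y)) ↔ R (Int.gcd y (-(x % y))) 0 := ih _ hlt y _ rfl
      have h7 : Int.gcd y (-(x % y)) = Int.gcd x y := by
        rw [Int.gcd_neg, Int.gcd_comm, Int.gcd_emod]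
      rw [h1' (-(x / y)) x y, e, hrot, h6, h7]

theorem transvection_invariant_of_gcd_eq {R : ℤ → ℤ → Prop}
    (h1 : ∀ k x y, R x y → R (x + k * y) y) (h2 : ∀ k x y, R x y → R x (y + k * x)) {x y x' y' : ℤ}
    (h : Int.gcd x y = Int.gcd x' y') (hR : R x y) : R x' y' := by
  rwa [transvection_invariant_iff_gcd h1 h2, ← h, ← transvection_invariant_iff_gcd h1 h2]

/-- Within each of the pairs `(x, y)`, `(z, w)` only the gcd matters, and `h5` couples the pairs.
With gcds `d1`, `d2` and `d = gcd d1 d2`, the chain is `(d,0,0,0) → (d,d,0,d) ~ (d,0,d,0) ~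
(d1,d1+d2,d2,d1+d2) → (d1,0,d2,0)`, where the arrows are `h5`. -/
theorem transvection_invariant_of_forall_zero {T : ℤ → ℤ → ℤ → ℤ → Prop}
    (h1 : ∀ k x y z w, T x y z w → T (x + k * y) y z w)
    (h2 : ∀ k x y z w, T x y z w → T x (y + k * x) z w)
    (h3 : ∀ k x y z w, T x y z w → T x y (z + k * w) w)
    (h4 : ∀ k x y z w, T x y z w → T x y z (w + k * z))
    (h5 : ∀ k x y z w, T x y z w → T x (y + k * (x + z)) z (w + k * (x + z)))
    (h0 : ∀ x y, T x y 0 0) (x y z w : ℤ) : T x y z w := by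
  have hl : ∀ {x y x' y' z w}, Int.gcd x y = Int.gcd x' y' → T x y z w → T x' y' z w :=
    fun {x y x' y' z w} h => transvection_invariant_of_gcd_eq (R := fun x y => T x y z w)
      (fun k x y => h1 k x y z w) (fun k x y => h2 k x y z w) h
  have hr : ∀ {x y z w z' w'}, Int.gcd z w = Int.gcd z' w' → T x y z w → T x y z' w' :=
    fun {x y z w z' w'} h => transvection_invariant_of_gcd_eq (R := fun z w => T x y z w)
      (fun k z w => h3 k x y z w) (fun k z w => h4 k x y z w) h
  set d1 : ℤ := ((Int.gcd x y : ℕ) : ℤ) with hd1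
  set d2 : ℤ := ((Int.gcd z w : ℕ) : ℤ) with hd2
  set d : ℤ := ((Int.gcd d1 d2 : ℕ) : ℤ) with hd
  have s1 : T d 0 d 0 := by
    have := h5 1 d 0 0 0 (h0 d 0)
    refine hl (x := d) (y := d) (by simp) (hr (z := 0) (w := d) (by simp) ?_)
    simpa using this
  have s2 : T d1 (d1 + d2) d2 (d1 + d2) := by
    refine hl (x := d) (y := 0) ?_ (hr (z := d) (w := 0) ?_ s1)
    · simp [hd]
    · rw [hd]; simp [Int.gcd_comm]
  have s3 : T d1 0 d2 0 := by simpa using h5 (-1) _ _ _ _ s2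
  refine hl (x := d1) (y := 0) (by simp [hd1]) (hr (z := d2) (w := 0) (by simp [hd2]) s3)

variable {g : ℕ}

/-- A property of pairs of integer vectors which is invariant under the transvections of a
Humphries system and holds for multiples of a basis vector holds always. -/
theorem transvection_induction (hg : 0 < g) {G : (Fin g → ℤ) → (Fin g → ℤ) → Prop}
    (h1 : ∀ k i m n, G m n → G (Function.update m i (m i + k * n i)) n)
    (h2 : ∀ k i m n, G m n → G m (Function.update n i (n i + k * m i)))
    (h3 : ∀ k (i j : Fin g), (j : ℕ) = i + 1 → ∀ m n, G m n →
      G m (Function.update (Function.update n i (n i + k * (m i + m j))) j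
        (n j + k * (m i + m j))))
    (h0 : ∀ d, G (Pi.single ⟨0, hg⟩ d) 0) (m n : Fin g → ℤ) : G m n := by
  have main : ∀ k, k < g → ∀ m n : Fin g → ℤ, (∀ i : Fin g, k < i → m i = 0 ∧ n i = 0) →
      G m n := by
    intro k
    induction k with
    | zero =>
      intro _ m n hmn
      have hz : ∀ f : Fin g → ℤ, (∀ i : Fin g, 0 < (i : ℕ) → f i = 0) →
          f = Function.update (0 : Fin g → ℤ) ⟨0, hg⟩ (f ⟨0, hg⟩) := by
        intro f hf
        ext i
        rcases eq_or_ne i ⟨0, hg⟩ with rfl | hi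
        · simp
        · rw [Function.update_of_ne hi]
          exact hf i (Nat.pos_of_ne_zero fun h => hi (Fin.ext h))
      rw [hz m fun i hi => (hmn i hi).1, hz n fun i hi => (hmn i hi).2]
      rw [transvection_invariant_iff_gcd
        (R := fun x y => G (Function.update (0 : Fin g → ℤ) ⟨0, hg⟩ x)
          (Function.update (0 : Fin g → ℤ) ⟨0, hg⟩ y))]
      · simpa [Pi.single] using h0 _
      · intro k x y h
        simpa using h1 k ⟨0, hg⟩ _ _ h
      · intro k x y h
        simpa using h2 k ⟨0, hg⟩ _ _ h
    | succ k ih =>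
      intro hk m n hmn
      set i : Fin g := ⟨k, by omega⟩ with hi
      set j : Fin g := ⟨k + 1, hk⟩ with hj
      have hij : i ≠ j := by simp [hi, hj]
      -- Only the coordinates at `k` and `k + 1` vary; once those at `k + 1` vanish the induction
      -- hypothesis applies.
      have key := transvection_invariant_of_forall_zero
        (T := fun x y z w => G (Function.update (Function.update m i x) j z)
          (Function.update (Function.update n i y) j w)) ?_ ?_ ?_ ?_ ?_ ?_ (m i) (n i) (m j) (n j)
      · simpa using key
      · intro k x y z w h
        simpa [hij, Function.update_comm hij] using h1 k i _ _ h
      · intro k x y z w h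
        simpa [hij, Function.update_comm hij] using h2 k i _ _ h
      · intro k x y z w h
        simpa [hij, Function.update_comm hij] using h1 k j _ _ h
      · intro k x y z w h
        simpa [hij, Function.update_comm hij] using h2 k j _ _ h
      · intro k x y z w h
        simpa [hij, Function.update_comm hij] using h3 k i j rfl _ _ h
      · intro x y
        refine ih (by omega) _ _ fun l hl => ?_
        rcases eq_or_ne l j with rfl | hlj
        · simp
        · have hli : l ≠ i := fun h => by rw [h] at hl; simp [hi] at hl
          rw [Function.update_of_ne hlj, Function.update_of_ne hli, Function.update_of_ne hlj,
            Function.update_of_ne hli]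
          refine hmn l ?_
          have : (l : ℕ) ≠ k + 1 := fun h => hlj (Fin.ext h)
          omega
  exact main (g - 1) (by omega) m n fun i hi => by omega

end Euclid

/-! ### Chord coordinates on the disc -/

/-- The point of the boundary circle at position `y`, where the `4g`-gon has sides of length one. -/
noncomputable def boundaryPoint (g : ℕ) (y : ℝ) : Disc :=
  ⟨(Circle.exp (2 * Real.pi * y / (4 * g)) : ℂ), by
    rw [mem_closedBall_zero_iff, Circle.norm_coe]⟩

theorem sidePoint_eq (g j : ℕ) (t : ℝ) : sidePoint g j t = boundaryPoint g (j + t) := rfl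

/-- Truncation of a real number to an interval. -/
noncomputable def clamp (a b x : ℝ) : ℝ := max a (min x b)

@[fun_prop]
theorem continuous_clamp (a b : ℝ) : Continuous (clamp a b) := by
  unfold clamp; fun_prop

theorem clamp_of_mem {a b x : ℝ} (h1 : a ≤ x) (h2 : x ≤ b) : clamp a b x = x := by
  rw [clamp, min_eq_left h2, max_eq_right h1]

theorem le_clamp (a b x : ℝ) : a ≤ clamp a b x := le_max_left _ _

theorem clamp_le {a b : ℝ} (h : a ≤ b) (x : ℝ) : clamp a b x ≤ b := max_le h (min_le_right _ _)

/-- The point with parameter `σ ∈ [-1, 1]` on the chord of the unit disc which connects the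
boundary points at positions `κ - x` and `κ + x`. -/
noncomputable def chordPoint (g : ℕ) (κ x σ : ℝ) : Disc :=
  ⟨Circle.exp (2 * Real.pi * κ / (4 * g)) *
    ((Real.cos (2 * Real.pi * x / (4 * g)) : ℝ) +
      (clamp (-1) 1 σ * Real.sin (2 * Real.pi * x / (4 * g)) : ℝ) * Complex.I), by
    rw [mem_closedBall_zero_iff, norm_mul, Circle.norm_coe, one_mul, Complex.norm_add_mul_I,
      Real.sqrt_le_one]
    have h1 := le_clamp (-1) 1 σ
    have h2 := clamp_le (show (-1 : ℝ) ≤ 1 by norm_num) σ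
    have h3 := Real.sin_sq_add_cos_sq (2 * Real.pi * x / (4 * g))
    have h4 : clamp (-1) 1 σ ^ 2 ≤ 1 := by nlinarith
    nlinarith [sq_nonneg (Real.sin (2 * Real.pi * x / (4 * g)))]⟩

@[fun_prop]
theorem continuous_chordPoint {Z : Type*} [TopologicalSpace Z] (g : ℕ) (κ : ℝ) {x σ : Z → ℝ}
    (hx : Continuous x) (hσ : Continuous σ) : Continuous fun z => chordPoint g κ (x z) (σ z) := by
  unfold chordPoint
  fun_prop

/-- The coordinates of a point of the disc with respect to the axis at position `κ`. -/
noncomputable def axisCoord (g : ℕ) (κ : ℝ) (z : Disc) : ℂ :=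
  (Circle.exp (-(2 * Real.pi * κ / (4 * g))) : ℂ) * z

/-- The half-length `x` of the arc cut off by the chord through `z` perpendicular to the axis at
position `κ`. -/
noncomputable def chordHeight (g : ℕ) (κ : ℝ) (z : Disc) : ℝ :=
  Real.arccos (axisCoord g κ z).re / (2 * Real.pi) * (4 * g)

/-- The parameter of `z` on the chord through `z` perpendicular to the axis at position `κ`; only
meaningful for chords away from the end points of the axis. -/
noncomputable def chordParam (g : ℕ) (κ : ℝ) (z : Disc) : ℝ :=
  (axisCoord g κ z).im / Real.sin (2 * Real.pi * clamp (1 / 2) (7 / 2) (chordHeight g κ z) / (4 * g))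

variable {g : ℕ}

/-- The clamp keeps the angle away from `0` and, because `7 / 2 < 2g`, below `π`; so the denominator
in `chordParam` never vanishes on the disc. -/
theorem sin_clamp_pos (hg : 2 ≤ g) (x : ℝ) :
    0 < Real.sin (2 * Real.pi * clamp (1 / 2) (7 / 2) x / (4 * g)) := by
  have h1 := le_clamp (1 / 2) (7 / 2) x
  have h2 := clamp_le (show (1 / 2 : ℝ) ≤ 7 / 2 by norm_num) x
  have hg' : (2 : ℝ) ≤ g := by exact_mod_cast hg
  have hπ := Real.pi_pos
  apply Real.sin_pos_of_pos_of_lt_pi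
  · positivity
  · rw [div_lt_iff₀ (by positivity)]
    nlinarith

@[fun_prop]
theorem continuous_axisCoord (g : ℕ) (κ : ℝ) : Continuous (axisCoord g κ) := by
  unfold axisCoord; fun_prop

@[fun_prop]
theorem continuous_chordHeight (g : ℕ) (κ : ℝ) : Continuous (chordHeight g κ) := by
  unfold chordHeight
  have := Real.continuous_arccos
  fun_prop

theorem continuous_chordParam (hg : 2 ≤ g) (κ : ℝ) : Continuous (chordParam g κ) := by
  unfold chordParam
  refine Continuous.div (by fun_prop) (by fun_prop) fun z => (sin_clamp_pos hg _).ne'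

theorem axisCoord_chordPoint (κ x σ : ℝ) : axisCoord g κ (chordPoint g κ x σ) =
    (Real.cos (2 * Real.pi * x / (4 * g)) : ℝ) +
      (clamp (-1) 1 σ * Real.sin (2 * Real.pi * x / (4 * g)) : ℝ) * Complex.I := by
  rw [axisCoord, chordPoint, ← mul_assoc, ← Circle.coe_mul, ← Circle.exp_add]
  simp

theorem norm_axisCoord_le (κ : ℝ) (z : Disc) : ‖axisCoord g κ z‖ ≤ 1 := by
  rw [axisCoord, norm_mul, Circle.norm_coe, one_mul]
  exact mem_closedBall_zero_iff.1 z.2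

theorem axisCoord_injective (κ : ℝ) : Function.Injective (axisCoord g κ) := by
  intro z w h
  exact Subtype.ext (mul_left_cancel₀ (Circle.coe_ne_zero _) h)

theorem re_im_ofReal_add_mul_I (x y : ℝ) : ((x : ℂ) + y * Complex.I).re = x ∧
    ((x : ℂ) + y * Complex.I).im = y := by simp

theorem chordHeight_chordPoint (hg : 2 ≤ g) (κ σ : ℝ) {x : ℝ} (h0 : 0 ≤ x) (h1 : x ≤ 2 * g) :
    chordHeight g κ (chordPoint g κ x σ) = x := by
  have hg' : (2 : ℝ) ≤ g := by exact_mod_cast hg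
  have hπ := Real.pi_pos
  rw [chordHeight, axisCoord_chordPoint, (re_im_ofReal_add_mul_I _ _).1, Real.arccos_cos]
  · field_simp
  · positivity
  · rw [div_le_iff₀ (by positivity)]
    nlinarith

theorem chordParam_chordPoint (hg : 2 ≤ g) (κ : ℝ) {x σ : ℝ} (h0 : 1 / 2 ≤ x) (h1 : x ≤ 7 / 2)
    (h2 : -1 ≤ σ) (h3 : σ ≤ 1) : chordParam g κ (chordPoint g κ x σ) = σ := by
  have hg' : (2 : ℝ) ≤ g := by exact_mod_cast hg
  rw [chordParam, chordHeight_chordPoint hg κ σ (by linarith) (by linarith), axisCoord_chordPoint,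
    (re_im_ofReal_add_mul_I _ _).2, clamp_of_mem h0 h1, clamp_of_mem h2 h3]
  have := sin_clamp_pos hg x
  rw [clamp_of_mem h0 h1] at this
  field_simp

/-- A point of the unit disc has imaginary axis coordinate bounded by the half-length of its chord,
the sine in the denominator. -/
theorem chordParam_mem (hg : 2 ≤ g) (κ : ℝ) {z : Disc} (h0 : 1 / 2 ≤ chordHeight g κ z)
    (h1 : chordHeight g κ z ≤ 7 / 2) : chordParam g κ z ∈ Set.Icc (-1 : ℝ) 1 ∧
      chordPoint g κ (chordHeight g κ z) (chordParam g κ z) = z := by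
  have hg' : (2 : ℝ) ≤ g := by exact_mod_cast hg
  have hπ := Real.pi_pos
  have hs := sin_clamp_pos hg (chordHeight g κ z)
  rw [clamp_of_mem h0 h1] at hs
  have hn := norm_axisCoord_le (g := g) κ z
  have hre := abs_le.1 ((Complex.abs_re_le_norm _).trans hn)
  have hang : 2 * Real.pi * chordHeight g κ z / (4 * g) = Real.arccos (axisCoord g κ z).re := by
    rw [chordHeight]; field_simp
  have hcos : Real.cos (2 * Real.pi * chordHeight g κ z / (4 * g)) = (axisCoord g κ z).re := by
    rw [hang, Real.cos_arccos hre.1 hre.2]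
  have him : chordParam g κ z * Real.sin (2 * Real.pi * chordHeight g κ z / (4 * g)) =
      (axisCoord g κ z).im := by
    rw [chordParam, clamp_of_mem h0 h1]
    field_simp
  have hsq : (axisCoord g κ z).im ^ 2 ≤ Real.sin (2 * Real.pi * chordHeight g κ z / (4 * g)) ^ 2 := by
    have h3 := Real.sin_sq_add_cos_sq (2 * Real.pi * chordHeight g κ z / (4 * g))
    rw [hcos] at h3
    have h4 : ‖axisCoord g κ z‖ ^ 2 ≤ 1 := by nlinarith [norm_nonneg (axisCoord g κ z)]
    rw [← Complex.normSq_eq_norm_sq, Complex.normSq_apply] at h4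
    nlinarith
  have hmem : chordParam g κ z ∈ Set.Icc (-1 : ℝ) 1 := by
    rw [← him, mul_pow] at hsq
    have h5 : chordParam g κ z ^ 2 ≤ 1 := by
      by_contra h
      nlinarith [pow_pos hs 2]
    exact abs_le.1 (by rwa [← sq_le_one_iff_abs_le_one])
  refine ⟨hmem, axisCoord_injective (g := g) κ ?_⟩
  rw [axisCoord_chordPoint, clamp_of_mem hmem.1 hmem.2, him, hcos, Complex.re_add_im]

theorem boundaryPoint_add (κ x : ℝ) : boundaryPoint g (κ + x) = chordPoint g κ x 1 := by
  apply axisCoord_injective (g := g) κ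
  rw [axisCoord_chordPoint, clamp_of_mem (by norm_num) le_rfl, axisCoord, boundaryPoint,
    ← Circle.coe_mul, ← Circle.exp_add]
  have : -(2 * Real.pi * κ / (4 * g)) + 2 * Real.pi * (κ + x) / (4 * g) =
    2 * Real.pi * x / (4 * g) := by ring
  rw [this, Circle.coe_exp, Complex.exp_mul_I]
  push_cast
  ring

theorem boundaryPoint_sub (κ x : ℝ) : boundaryPoint g (κ - x) = chordPoint g κ x (-1) := by
  apply axisCoord_injective (g := g) κ
  rw [axisCoord_chordPoint, clamp_of_mem le_rfl (by norm_num), axisCoord, boundaryPoint,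
    ← Circle.coe_mul, ← Circle.exp_add]
  have : -(2 * Real.pi * κ / (4 * g)) + 2 * Real.pi * (κ - x) / (4 * g) =
    -(2 * Real.pi * x / (4 * g)) := by ring
  rw [this, Circle.coe_exp, Complex.exp_mul_I]
  push_cast
  rw [Complex.cos_neg, Complex.sin_neg]
  ring

theorem boundaryPoint_add_period (hg : 2 ≤ g) (y : ℝ) :
    boundaryPoint g (y + 4 * g) = boundaryPoint g y := by
  have hg' : (2 : ℝ) ≤ g := by exact_mod_cast hg
  have : 2 * Real.pi * (y + 4 * g) / (4 * g) = 2 * Real.pi * y / (4 * g) + 2 * Real.pi := by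
    field_simp
  simp only [boundaryPoint, this, Circle.exp_add_two_pi]

theorem chordHeight_boundaryPoint (hg : 2 ≤ g) {κ y : ℝ} (h : |y - κ| ≤ 2 * g) :
    chordHeight g κ (boundaryPoint g y) = |y - κ| := by
  rcases abs_cases (y - κ) with ⟨h1, h2⟩ | ⟨h1, h2⟩
  · have e : y = κ + |y - κ| := by rw [h1]; ring
    conv_lhs => rw [e, boundaryPoint_add]
    exact chordHeight_chordPoint hg κ 1 (abs_nonneg _) h
  · have e : y = κ - |y - κ| := by rw [h1]; ring
    conv_lhs => rw [e, boundaryPoint_sub]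
    exact chordHeight_chordPoint hg κ (-1) (abs_nonneg _) h

/-- Positions count modulo `4g`: beyond half the perimeter the relevant distance is `4g - |y - κ|`.
-/
theorem le_chordHeight_boundaryPoint (hg : 2 ≤ g) {κ y c : ℝ} (h1 : c ≤ |y - κ|)
    (h2 : |y - κ| ≤ 4 * g - c) (hc : 0 ≤ c) : c ≤ chordHeight g κ (boundaryPoint g y) := by
  rcases le_or_gt |y - κ| (2 * g) with h | h
  · rwa [chordHeight_boundaryPoint hg h]
  · rcases abs_cases (y - κ) with ⟨h3, h4⟩ | ⟨h3, h4⟩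
    · have e : |(y - 4 * g) - κ| = 4 * g - |y - κ| := by
        rw [abs_of_nonpos (by linarith), h3]; ring
      rw [← sub_add_cancel y (4 * g : ℝ), boundaryPoint_add_period hg,
        chordHeight_boundaryPoint hg (by rw [e]; linarith), e]
      linarith
    · have e : |(y + 4 * g) - κ| = 4 * g - |y - κ| := by
        rw [abs_of_nonneg (by linarith), h3]; ring
      rw [← boundaryPoint_add_period hg,
        chordHeight_boundaryPoint hg (by rw [e]; linarith), e]
      linarith

/-! ### Concatenation of families of paths -/

/-- The path (depending on a parameter `x`) obtained by concatenating the paths `e k x` on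
`[-1, 1]`. -/
noncomputable def glue {X : Type*} (e : ℤ → ℝ → ℝ → X) (x s : ℝ) : X :=
  e ⌊(s + 1) / 2⌋ x (s - 2 * ⌊(s + 1) / 2⌋)

/-- At `σ = 1` the floor already selects the next piece, and `he` repairs this. -/
theorem glue_add {X : Type*} {e : ℤ → ℝ → ℝ → X} (he : ∀ k x, e k x 1 = e (k + 1) x (-1))
    (k : ℤ) (x : ℝ) {σ : ℝ} (hσ : σ ∈ Set.Icc (-1 : ℝ) 1) : glue e x (2 * k + σ) = e k x σ := by
  unfold glue
  rcases eq_or_lt_of_le hσ.2 with rfl | h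
  · have : ⌊(2 * (k : ℝ) + 1 + 1) / 2⌋ = k + 1 := by
      rw [Int.floor_eq_iff]; push_cast; constructor <;> linarith
    rw [this, he]
    congr 1
    push_cast; ring
  · have : ⌊(2 * (k : ℝ) + σ + 1) / 2⌋ = k := by
      rw [Int.floor_eq_iff]; constructor <;> linarith [hσ.1]
    rw [this]
    congr 1
    ring

theorem exists_eq_two_mul_add (s : ℝ) : ∃ k : ℤ, ∃ σ ∈ Set.Icc (-1 : ℝ) 1, s = 2 * k + σ := by
  refine ⟨⌊(s + 1) / 2⌋, s - 2 * ⌊(s + 1) / 2⌋, ⟨?_, ?_⟩, by ring⟩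
  · linarith [Int.floor_le ((s + 1) / 2)]
  · linarith [Int.lt_floor_add_one ((s + 1) / 2)]

theorem continuous_glue {X : Type*} [TopologicalSpace X] {e : ℤ → ℝ → ℝ → X}
    (he : ∀ k x, e k x 1 = e (k + 1) x (-1)) (hc : ∀ k, Continuous fun u : ℝ × ℝ => e k u.1 u.2) :
    Continuous fun u : ℝ × ℝ => glue e u.1 u.2 := by
  have hfin : LocallyFinite fun k : ℤ =>
      {u : ℝ × ℝ | u.2 ∈ Set.Icc (2 * (k : ℝ) - 1) (2 * k + 1)} := by
    intro u
    refine ⟨{v | v.2 ∈ Set.Ioo (u.2 - 1) (u.2 + 1)},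
      (isOpen_Ioo.preimage continuous_snd).mem_nhds (by simp), ?_⟩
    refine (Set.finite_Icc (⌊u.2 / 2⌋ - 2) (⌊u.2 / 2⌋ + 3)).subset ?_
    rintro k ⟨v, ⟨h1, h2⟩, h3, h4⟩
    have h5 := Int.floor_le (u.2 / 2)
    have h6 := Int.lt_floor_add_one (u.2 / 2)
    constructor
    · have : ((⌊u.2 / 2⌋ - 2 : ℤ) : ℝ) ≤ k := by push_cast; linarith
      exact_mod_cast this
    · have : (k : ℝ) ≤ ((⌊u.2 / 2⌋ + 3 : ℤ) : ℝ) := by push_cast; linarith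
      exact_mod_cast this
  refine hfin.continuous ?_ (fun k => isClosed_Icc.preimage continuous_snd) fun k => ?_
  · refine Set.eq_univ_of_forall fun u => ?_
    obtain ⟨k, σ, hσ, h⟩ := exists_eq_two_mul_add u.2
    refine Set.mem_iUnion.2 ⟨k, ?_, ?_⟩ <;> linarith [hσ.1, hσ.2]
  · have h1 : ContinuousOn (fun u : ℝ × ℝ => e k u.1 (u.2 - 2 * k))
        {u : ℝ × ℝ | u.2 ∈ Set.Icc (2 * (k : ℝ) - 1) (2 * k + 1)} :=
      ((hc k).comp (g := fun u : ℝ × ℝ => e k u.1 u.2)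
        (f := fun u : ℝ × ℝ => (u.1, u.2 - 2 * (k : ℝ))) (by fun_prop)).continuousOn
    refine h1.congr fun u hu => ?_
    have := glue_add he k u.1 (σ := u.2 - 2 * k) ⟨by linarith [hu.1], by linarith [hu.2]⟩
    rw [add_sub_cancel] at this
    exact this

theorem glue_smul {A X : Type*} [SMul A X] {e : ℤ → ℝ → ℝ → X}
    {l : ℤ} {c : A} (h : ∀ k x σ, e (k + l) x σ = c • e k x σ) (x s : ℝ) :
    glue e x (s + 2 * l) = c • glue e x s := by
  unfold glue
  have : ⌊(s + 2 * l + 1) / 2⌋ = ⌊(s + 1) / 2⌋ + l := by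
    rw [← Int.floor_add_intCast]; congr 1; ring
  rw [this, h]
  congr 2
  push_cast; ring

/-- The trivial group acts on every type. -/
@[reducible]
def trivialAction (Z : Type*) : MulAction PUnit.{1} Z where
  smul _ z := z
  one_smul _ := rfl
  mul_smul _ _ _ := rfl

/-! ### Dehn twists in one slab -/

section SlabTwist

variable {A X : Type*} [CommGroup A] [MulAction A X] {g : ℕ}

/-- The lifts of the closed curves formed by the chords of the disc in the slab between the sides
around the axis at position `κ`. -/
noncomputable def slabPath (g : ℕ) (P : Disc → X) (a : A) (κ : ℝ) : ℝ → ℝ → X :=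
  glue fun k x σ => a ^ (-k) • P (chordPoint g κ (clamp (1 / 2) (3 / 2) x) σ)

/-- The effect on `P` of `ε` Dehn twists in the annulus formed by the slab between the sides around
the axis at position `κ`. -/
noncomputable def slabTwist (g : ℕ) (P : Disc → X) (a : A) (κ : ℝ) (ε : ℤ) (z : Disc) : X :=
  if chordHeight g κ z ≤ 1 / 2 then P z
  else if chordHeight g κ z ≤ 3 / 2 then
    slabPath g P a κ (chordHeight g κ z) (chordParam g κ z + 2 * ε * (chordHeight g κ z - 1 / 2))
  else a ^ (-ε) • P z

variable {P : Disc → X} {a : A} {κ : ℝ}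

/-- A parameter shift by `2` is one turn around the annulus, so this is the monodromy of its core
curve. -/
theorem slabPath_add (P : Disc → X) (a : A) (κ x s : ℝ) (l : ℤ) :
    slabPath g P a κ x (s + 2 * l) = a ^ (-l) • slabPath g P a κ x s :=
  glue_smul (fun k x σ => by rw [neg_add_rev, zpow_add, mul_smul]) x s

/-- The chords in the slab close up, up to the deck transformation `a`. -/
def SlabCloses (g : ℕ) (P : Disc → X) (a : A) (κ : ℝ) : Prop :=
  ∀ x ∈ Set.Icc (1 / 2 : ℝ) (3 / 2), P (chordPoint g κ x (-1)) = a • P (chordPoint g κ x 1)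

theorem clamp_mem_slab (x : ℝ) : clamp (1 / 2) (3 / 2) x ∈ Set.Icc (1 / 2 : ℝ) (3 / 2) :=
  ⟨le_clamp _ _ _, clamp_le (by norm_num) _⟩

theorem SlabCloses.glue_compat (h : SlabCloses g P a κ) (k : ℤ) (x : ℝ) :
    a ^ (-k) • P (chordPoint g κ (clamp (1 / 2) (3 / 2) x) 1) =
      a ^ (-(k + 1)) • P (chordPoint g κ (clamp (1 / 2) (3 / 2) x) (-1)) := by
  rw [h _ (clamp_mem_slab x), smul_smul, ← zpow_add_one]
  congr 2
  ring

theorem slabPath_eq (h : SlabCloses g P a κ) (k : ℤ) {x σ : ℝ}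
    (hx : x ∈ Set.Icc (1 / 2 : ℝ) (3 / 2)) (hσ : σ ∈ Set.Icc (-1 : ℝ) 1) :
    slabPath g P a κ x (2 * k + σ) = a ^ (-k) • P (chordPoint g κ x σ) := by
  rw [slabPath, glue_add h.glue_compat k x hσ, clamp_of_mem hx.1 hx.2]

theorem slabTwist_of_le (ε : ℤ) {z : Disc} (hz : chordHeight g κ z ≤ 1 / 2) :
    slabTwist g P a κ ε z = P z := if_pos hz

theorem slabPath_height_eq_of_le (hg : 2 ≤ g) (h : SlabCloses g P a κ) (ε : ℤ) {z : Disc}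
    (hz : chordHeight g κ z = 1 / 2) :
    slabPath g P a κ (chordHeight g κ z)
      (chordParam g κ z + 2 * ε * (chordHeight g κ z - 1 / 2)) = P z := by
  obtain ⟨h1, h2⟩ := chordParam_mem hg κ (z := z) (by linarith) (by linarith)
  have := slabPath_eq h 0 (x := chordHeight g κ z) ⟨by linarith, by linarith⟩ h1
  rw [h2] at this
  simp only [neg_zero, zpow_zero, one_smul, Int.cast_zero, mul_zero, zero_add] at this
  rw [← this]
  congr 1
  rw [hz]; ring

/-- At the outer edge the shift has grown to `2ε`, that is `ε` full turns. -/
theorem slabPath_height_eq_of_ge (hg : 2 ≤ g) (h : SlabCloses g P a κ) (ε : ℤ) {z : Disc}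
    (hz : chordHeight g κ z = 3 / 2) :
    slabPath g P a κ (chordHeight g κ z)
      (chordParam g κ z + 2 * ε * (chordHeight g κ z - 1 / 2)) = a ^ (-ε) • P z := by
  obtain ⟨h1, h2⟩ := chordParam_mem hg κ (z := z) (by linarith) (by linarith)
  have := slabPath_eq h ε (x := chordHeight g κ z) ⟨by linarith, by linarith⟩ h1
  rw [h2] at this
  rw [← this]
  congr 1
  rw [hz]; ring

theorem slabTwist_of_mem (hg : 2 ≤ g) (h : SlabCloses g P a κ) (ε : ℤ) {z : Disc}
    (hz : chordHeight g κ z ∈ Set.Icc (1 / 2 : ℝ) (3 / 2)) :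
    slabTwist g P a κ ε z = slabPath g P a κ (chordHeight g κ z)
      (chordParam g κ z + 2 * ε * (chordHeight g κ z - 1 / 2)) := by
  unfold slabTwist
  split_ifs with h1 h2
  · exact (slabPath_height_eq_of_le hg h ε (le_antisymm h1 hz.1)).symm
  · rfl
  · exact absurd hz.2 h2

theorem slabTwist_of_ge (hg : 2 ≤ g) (h : SlabCloses g P a κ) (ε : ℤ) {z : Disc}
    (hz : 3 / 2 ≤ chordHeight g κ z) : slabTwist g P a κ ε z = a ^ (-ε) • P z := by
  rcases hz.eq_or_lt with h1 | h1
  · rw [slabTwist_of_mem hg h ε ⟨by linarith, by linarith⟩, slabPath_height_eq_of_ge hg h ε h1.symm]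
  · rw [slabTwist, if_neg (by linarith), if_neg (by linarith)]

theorem slabTwist_chordPoint (hg : 2 ≤ g) (h : SlabCloses g P a κ) (ε : ℤ) {x σ : ℝ}
    (hx : x ∈ Set.Icc (1 / 2 : ℝ) (3 / 2)) (hσ : σ ∈ Set.Icc (-1 : ℝ) 1) :
    slabTwist g P a κ ε (chordPoint g κ x σ) =
      slabPath g P a κ x (σ + 2 * ε * (x - 1 / 2)) := by
  have hg' : (2 : ℝ) ≤ g := by exact_mod_cast hg
  have h1 : chordHeight g κ (chordPoint g κ x σ) = x :=
    chordHeight_chordPoint hg κ σ (by linarith [hx.1]) (by linarith [hx.2])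
  rw [slabTwist_of_mem hg h ε (by rwa [h1]), h1,
    chordParam_chordPoint hg κ hx.1 (by linarith [hx.2]) hσ.1 hσ.2]

theorem continuous_slabPath [TopologicalSpace X] [ContinuousConstSMul A X] (hP : Continuous P)
    (h : SlabCloses g P a κ) : Continuous fun u : ℝ × ℝ => slabPath g P a κ u.1 u.2 :=
  continuous_glue h.glue_compat fun k => by fun_prop

theorem continuous_slabTwist [TopologicalSpace X] [ContinuousConstSMul A X] (hg : 2 ≤ g) (hP : Continuous P)
    (h : SlabCloses g P a κ) (ε : ℤ) : Continuous (slabTwist g P a κ ε) := by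
  have h1 := continuous_slabPath hP h
  have h2 := continuous_chordParam hg κ
  have h3 := continuous_chordHeight g κ
  refine Continuous.if_le hP (Continuous.if_le ?_ (hP.const_smul _) h3 continuous_const ?_) h3
    continuous_const ?_
  · exact h1.comp (f := fun z => (chordHeight g κ z,
      chordParam g κ z + 2 * ε * (chordHeight g κ z - 1 / 2))) (by fun_prop)
  · exact fun z hz => slabPath_height_eq_of_ge hg h ε hz
  · intro z hz
    rw [if_pos (by linarith)]
    exact (slabPath_height_eq_of_le hg h ε hz).symm

theorem map_slabPath {S : Type*} {p : X → S} (hp : ∀ (a : A) x, p (a • x) = p x) (P : Disc → X)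
    (a : A) (κ x s : ℝ) : p (slabPath g P a κ x s) =
      letI := trivialAction S
      slabPath g (p ∘ P) (1 : PUnit) κ x s := by
  simp only [slabPath, glue, hp]
  rfl

/-- The projection forgets the group factors, so the twisted lift covers the same formula for the
trivial group on the base. -/
theorem map_slabTwist {S : Type*} {p : X → S} (hp : ∀ (a : A) x, p (a • x) = p x) (P : Disc → X)
    (a : A) (κ : ℝ) (ε : ℤ) (z : Disc) : p (slabTwist g P a κ ε z) =
      letI := trivialAction S
      slabTwist g (p ∘ P) (1 : PUnit) κ ε z := by
  unfold slabTwist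
  split_ifs
  · rfl
  · exact map_slabPath hp P a κ _ _
  · rw [hp]; rfl

/-- In the slab the chord stays fixed and opposite shifts cancel; the whole turns removed to bring
the parameter back into `[-1, 1]` do not matter on the base. -/
theorem slabTwist_leftInverse {S : Type*} (hg : 2 ≤ g) {Q : Disc → S}
    {f : S → S} {ε ε' : ℤ} (hε : ε + ε' = 0)
    (h : letI := trivialAction S; SlabCloses g Q (1 : PUnit) κ)
    (hf : ∀ z, f (Q z) = letI := trivialAction S; slabTwist g Q (1 : PUnit) κ ε' z) (z : Disc) :
    f (letI := trivialAction S; slabTwist g Q (1 : PUnit) κ ε z) = Q z := by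
  let _ := trivialAction S
  rcases le_total (chordHeight g κ z) (1 / 2) with h1 | h1
  · rw [slabTwist_of_le _ h1, hf, slabTwist_of_le _ h1]
  rcases le_total (3 / 2) (chordHeight g κ z) with h2 | h2
  · rw [slabTwist_of_ge hg h _ h2]
    change f (Q z) = _
    rw [hf, slabTwist_of_ge hg h _ h2]
    rfl
  · rw [slabTwist_of_mem hg h _ ⟨h1, h2⟩]
    obtain ⟨k, σ, hσ, hs⟩ := exists_eq_two_mul_add
      (chordParam g κ z + 2 * ε * (chordHeight g κ z - 1 / 2))
    rw [hs, slabPath_eq h k ⟨h1, h2⟩ hσ]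
    change f (Q _) = _
    rw [hf, slabTwist_chordPoint hg h _ ⟨h1, h2⟩ hσ]
    have h3 : σ + 2 * ε' * (chordHeight g κ z - 1 / 2) =
        2 * ((0 : ℤ) : ℝ) + chordParam g κ z + 2 * ((-k : ℤ) : ℝ) := by
      have : (ε' : ℝ) = -ε := by
        have : ((ε + ε' : ℤ) : ℝ) = 0 := by rw [hε]; simp
        push_cast at this; linarith
      rw [this]; push_cast; linarith
    obtain ⟨h4, h5⟩ := chordParam_mem hg κ h1 (by linarith)
    rw [h3, slabPath_add, slabPath_eq h 0 ⟨h1, h2⟩ h4, h5]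
    rfl

/-- The axis at `j + 3 / 2` passes through the middle of side `j + 1`; reflection in it exchanges
sides `j` and `j + 2` just as the side pairing does. -/
theorem sidePoint_left (j : ℕ) (t : ℝ) :
    sidePoint g j t = chordPoint g (j + 3 / 2) (3 / 2 - t) (-1) := by
  rw [sidePoint_eq, ← boundaryPoint_sub]; congr 1; ring

theorem sidePoint_right (j : ℕ) (t : ℝ) :
    sidePoint g (j + 2) (1 - t) = chordPoint g (j + 3 / 2) (3 / 2 - t) 1 := by
  rw [sidePoint_eq, ← boundaryPoint_add]; congr 1; push_cast; ring

theorem chordHeight_sidePoint_mid (hg : 2 ≤ g) (j : ℕ) {t : ℝ} (ht : t ∈ Set.Icc (0 : ℝ) 1) :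
    chordHeight g (j + 3 / 2) (sidePoint g (j + 1) t) ≤ 1 / 2 := by
  have hg' : (2 : ℝ) ≤ g := by exact_mod_cast hg
  have h1 : |((j + 1 : ℕ) : ℝ) + t - (j + 3 / 2)| ≤ 1 / 2 := by
    rw [abs_le]; push_cast; constructor <;> linarith [ht.1, ht.2]
  rw [sidePoint_eq, chordHeight_boundaryPoint hg (by linarith)]
  exact h1

theorem chordHeight_sidePoint_far (hg : 2 ≤ g) {j k : ℕ} (hj : j + 2 < 4 * g) (hk : k < 4 * g)
    (h : k < j ∨ j + 2 < k) {t : ℝ} (ht : t ∈ Set.Icc (0 : ℝ) 1) :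
    3 / 2 ≤ chordHeight g (j + 3 / 2) (sidePoint g k t) := by
  rw [sidePoint_eq]
  have hj' : (j : ℝ) + 3 ≤ 4 * g := by exact_mod_cast hj
  have hk' : (k : ℝ) + 1 ≤ 4 * g := by exact_mod_cast hk
  have hj0 : (0 : ℝ) ≤ j := j.cast_nonneg
  have hk0 : (0 : ℝ) ≤ k := k.cast_nonneg
  obtain ⟨ht0, ht1⟩ := ht
  apply le_chordHeight_boundaryPoint hg _ _ (by norm_num)
  · rcases h with h | h
    · have : (k : ℝ) + 1 ≤ j := by exact_mod_cast h
      rw [abs_of_nonpos (by linarith)]; linarith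
    · have : (j : ℝ) + 3 ≤ k := by exact_mod_cast h
      rw [abs_of_nonneg (by linarith)]; linarith
  · rw [abs_le]; constructor <;> linarith

/-- A pairing of two sides up to a period. -/
def SidesPaired (g : ℕ) (P : Disc → X) (j : ℕ) (c : A) : Prop :=
  ∀ t ∈ Set.Icc (0 : ℝ) 1, P (sidePoint g j t) = c • P (sidePoint g (j + 2) (1 - t))

theorem SidesPaired.slabCloses {j : ℕ} (h : SidesPaired g P j a) :
    SlabCloses g P a (j + 3 / 2) := by
  intro x hx
  have := h (3 / 2 - x) ⟨by linarith [hx.2], by linarith [hx.1]⟩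
  rwa [sidePoint_left, sidePoint_right, sub_sub_cancel] at this

theorem one_sub_mem_Icc {t : ℝ} (ht : t ∈ Set.Icc (0 : ℝ) 1) : 1 - t ∈ Set.Icc (0 : ℝ) 1 :=
  ⟨by linarith [ht.2], by linarith [ht.1]⟩

/-- Both ends of a chord are shifted equally, and their parameters `-1` and `1` still differ by one
turn. -/
theorem SidesPaired.slabTwist_self (hg : 2 ≤ g) {j : ℕ} (h : SidesPaired g P j a) (ε : ℤ) :
    SidesPaired g (slabTwist g P a (j + 3 / 2) ε) j a := by
  intro t ht
  have hx : 3 / 2 - t ∈ Set.Icc (1 / 2 : ℝ) (3 / 2) := ⟨by linarith [ht.2], by linarith [ht.1]⟩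
  rw [sidePoint_left, sidePoint_right, slabTwist_chordPoint hg h.slabCloses ε hx (by norm_num),
    slabTwist_chordPoint hg h.slabCloses ε hx (by norm_num)]
  have : 1 + 2 * (ε : ℝ) * (3 / 2 - t - 1 / 2) =
    -1 + 2 * (ε : ℝ) * (3 / 2 - t - 1 / 2) + 2 * ((1 : ℤ) : ℝ) := by push_cast; ring
  rw [this, slabPath_add, zpow_neg_one, smul_inv_smul]

theorem SidesPaired.slabTwist_far (hg : 2 ≤ g) {j k : ℕ} (h : SidesPaired g P j a) (ε : ℤ) {c : A}
    (hk : SidesPaired g P k c) (hj : j + 2 < 4 * g) (hk' : k + 2 < 4 * g)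
    (hjk : k + 2 < j ∨ j + 2 < k) : SidesPaired g (slabTwist g P a (j + 3 / 2) ε) k c := by
  intro t ht
  rw [slabTwist_of_ge hg h.slabCloses ε
      (chordHeight_sidePoint_far hg hj (by omega) (by omega) ht),
    slabTwist_of_ge hg h.slabCloses ε
      (chordHeight_sidePoint_far hg hj (by omega) (by omega) (one_sub_mem_Icc ht)), hk t ht,
    smul_comm]

/-- Side `j + 1` lies in the cap left fixed, its partner `j + 3` in the region moved by `a ^ (-ε)`;
the period absorbs the difference. -/
theorem SidesPaired.slabTwist_succ (hg : 2 ≤ g) {j : ℕ} (h : SidesPaired g P j a) (ε : ℤ) {c : A}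
    (hk : SidesPaired g P (j + 1) c) (hj : j + 3 < 4 * g) :
    SidesPaired g (slabTwist g P a (j + 3 / 2) ε) (j + 1) (c * a ^ ε) := by
  intro t ht
  rw [slabTwist_of_le ε (chordHeight_sidePoint_mid hg j ht),
    slabTwist_of_ge hg h.slabCloses ε
      (chordHeight_sidePoint_far hg (by omega) (by omega) (by omega) (one_sub_mem_Icc ht)), hk t ht,
    smul_smul, mul_assoc, ← zpow_add]
  simp

/-- Now the partner lies in the fixed cap, hence the opposite sign. -/
theorem SidesPaired.slabTwist_pred (hg : 2 ≤ g) {j : ℕ} (h : SidesPaired g P (j + 1) a) (ε : ℤ)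
    {c : A} (hk : SidesPaired g P j c) (hj : j + 3 < 4 * g) :
    SidesPaired g (slabTwist g P a ((j + 1 : ℕ) + 3 / 2) ε) j (c * a ^ (-ε)) := by
  intro t ht
  rw [slabTwist_of_ge hg h.slabCloses ε
      (chordHeight_sidePoint_far hg (by omega) (by omega) (by omega) ht),
    slabTwist_of_le ε (chordHeight_sidePoint_mid hg (j + 1) (one_sub_mem_Icc ht)), hk t ht,
    smul_smul, mul_comm]

theorem isPeriodLift_iff [TopologicalSpace X] {a b : Fin g → A} : IsPeriodLift P a b ↔ Continuous P ∧
    (∀ i : Fin g, SidesPaired g P (4 * i) (a i)) ∧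
    ∀ i : Fin g, SidesPaired g P (4 * i + 1) (b i) :=
  ⟨fun h => ⟨h.1, h.2, h.3⟩, fun h => ⟨h.1, h.2.1, h.2.2⟩⟩

theorem fin_lt_or_lt_of_ne {i j : Fin g} (h : i ≠ j) : (i : ℕ) < j ∨ (j : ℕ) < i := by
  have : (i : ℕ) ≠ j := fun h' => h (Fin.ext h')
  omega

/-- The effect on the periods of a Dehn twist in the annulus crossing the sides `a i`. -/
theorem IsPeriodLift.slabTwist_a [TopologicalSpace X] [ContinuousConstSMul A X] (hg : 2 ≤ g) {a b : Fin g → A}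
    (h : IsPeriodLift P a b) (i : Fin g) (ε : ℤ) :
    IsPeriodLift (slabTwist g P (a i) ((4 * i : ℕ) + 3 / 2) ε) a
      (Function.update b i (b i * a i ^ ε)) := by
  rw [isPeriodLift_iff] at h ⊢
  obtain ⟨h0, h1, h2⟩ := h
  have hi := i.2
  refine ⟨continuous_slabTwist hg h0 (h1 i).slabCloses ε, fun k => ?_, fun k => ?_⟩
  · have hk := k.2
    rcases eq_or_ne k i with rfl | hki
    · exact (h1 k).slabTwist_self hg ε
    · have := fin_lt_or_lt_of_ne hki
      exact (h1 i).slabTwist_far hg ε (h1 k) (by omega) (by omega) (by omega)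
  · have hk := k.2
    rcases eq_or_ne k i with rfl | hki
    · rw [Function.update_self]
      exact (h1 k).slabTwist_succ hg ε (h2 k) (by omega)
    · have := fin_lt_or_lt_of_ne hki
      rw [Function.update_of_ne hki]
      exact (h1 i).slabTwist_far hg ε (h2 k) (by omega) (by omega) (by omega)

/-- The effect on the periods of a Dehn twist in the annulus crossing the sides `b i`. -/
theorem IsPeriodLift.slabTwist_b [TopologicalSpace X] [ContinuousConstSMul A X] (hg : 2 ≤ g) {a b : Fin g → A}
    (h : IsPeriodLift P a b) (i : Fin g) (ε : ℤ) :
    IsPeriodLift (slabTwist g P (b i) ((4 * i + 1 : ℕ) + 3 / 2) ε)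
      (Function.update a i (a i * b i ^ (-ε))) b := by
  rw [isPeriodLift_iff] at h ⊢
  obtain ⟨h0, h1, h2⟩ := h
  have hi := i.2
  refine ⟨continuous_slabTwist hg h0 (h2 i).slabCloses ε, fun k => ?_, fun k => ?_⟩
  · have hk := k.2
    rcases eq_or_ne k i with rfl | hki
    · rw [Function.update_self]
      exact (h2 k).slabTwist_pred hg ε (h1 k) (by omega)
    · have := fin_lt_or_lt_of_ne hki
      rw [Function.update_of_ne hki]
      exact (h2 i).slabTwist_far hg ε (h1 k) (by omega) (by omega) (by omega)
  · have hk := k.2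
    rcases eq_or_ne k i with rfl | hki
    · exact (h2 k).slabTwist_self hg ε
    · have := fin_lt_or_lt_of_ne hki
      exact (h2 i).slabTwist_far hg ε (h2 k) (by omega) (by omega) (by omega)

end SlabTwist

/-! ### Dehn twists in a pair of slabs -/

section PairTwist

variable {A X : Type*} [CommGroup A] [MulAction A X] {g : ℕ}

/-- The lifts of the chords in a pair of parallel slabs perpendicular to the axis at position
`κ`. -/
noncomputable def pairSegment (g : ℕ) (P : Disc → X) (b c : A) (κ : ℝ) (k : ℤ) (x σ : ℝ) : X :=
  if Even k then (b * c) ^ (k / 2) • P (chordPoint g κ (clamp (1 / 2) (3 / 2) x) σ)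
  else ((b * c) ^ (k / 2) * c) • P (chordPoint g κ (4 - clamp (1 / 2) (3 / 2) x) (-σ))

/-- The lifts of the closed curves formed by pairs of parallel chords of the disc perpendicular to
the axis at position `κ`. -/
noncomputable def pairPath (g : ℕ) (P : Disc → X) (b c : A) (κ : ℝ) : ℝ → ℝ → X :=
  glue (pairSegment g P b c κ)

/-- The effect on `P` of `ε` Dehn twists in the annulus formed by a pair of parallel slabs
perpendicular to the axis at position `κ`. -/
noncomputable def pairTwist (g : ℕ) (P : Disc → X) (b c : A) (κ : ℝ) (ε : ℤ) (z : Disc) : X :=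
  if chordHeight g κ z ≤ 1 / 2 then P z
  else if chordHeight g κ z ≤ 3 / 2 then
    pairPath g P b c κ (chordHeight g κ z) (chordParam g κ z + 4 * ε * (chordHeight g κ z - 1 / 2))
  else if chordHeight g κ z ≤ 5 / 2 then (b * c) ^ ε • P z
  else if chordHeight g κ z ≤ 7 / 2 then
    c⁻¹ • pairPath g P b c κ (4 - chordHeight g κ z)
      (2 - chordParam g κ z + 4 * ε * (7 / 2 - chordHeight g κ z))
  else P z

/-- The pairs of chords in the two slabs close up, up to deck transformations. -/
def PairCloses (g : ℕ) (P : Disc → X) (b c : A) (κ : ℝ) : Prop :=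
  ∀ x ∈ Set.Icc (1 / 2 : ℝ) (3 / 2),
    P (chordPoint g κ (4 - x) (-1)) = b • P (chordPoint g κ x (-1)) ∧
    P (chordPoint g κ x 1) = c • P (chordPoint g κ (4 - x) 1)

variable {P : Disc → X} {b c : A} {κ : ℝ}

/-- Inner chords run forwards and outer chords backwards, so successive segments cross the two side
pairs alternately, picking up `c` after an even segment and `b` after an odd one. -/
theorem PairCloses.glue_compat (h : PairCloses g P b c κ) (k : ℤ) (x : ℝ) :
    pairSegment g P b c κ k x 1 = pairSegment g P b c κ (k + 1) x (-1) := by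
  unfold pairSegment
  obtain ⟨h1, h2⟩ := h _ (clamp_mem_slab x)
  by_cases hk : Even k
  · have hk' : ¬ Even (k + 1) := by rw [Int.even_add_one]; exact not_not.2 hk
    have e : (k + 1) / 2 = k / 2 := by obtain ⟨l, rfl⟩ := hk; omega
    rw [if_pos hk, if_neg hk', e, h2, smul_smul, neg_neg]
  · have hk' : Even (k + 1) := by rw [Int.even_add_one]; exact hk
    have e : (k + 1) / 2 = k / 2 + 1 := by
      obtain ⟨l, rfl⟩ := Int.not_even_iff_odd.1 hk; omega
    rw [if_neg hk, if_pos hk', e, h1, smul_smul, zpow_add_one, mul_assoc, mul_comm c b]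

theorem pairPath_add (P : Disc → X) (b c : A) (κ x s : ℝ) (l : ℤ) :
    pairPath g P b c κ x (s + 4 * l) = (b * c) ^ l • pairPath g P b c κ x s := by
  have := glue_smul (l := 2 * l) (c := (b * c) ^ l) (e := pairSegment g P b c κ)
    (fun k x σ => by
      have e : (k + 2 * l) / 2 = l + k / 2 := by omega
      have e' : Even (k + 2 * l) ↔ Even k := by simp [Int.even_add]
      simp only [pairSegment, e, e', zpow_add]
      split_ifs <;> simp only [mul_smul]) x s
  rw [pairPath, ← this]
  congr 1
  push_cast; ring

theorem pairPath_even (h : PairCloses g P b c κ) (l : ℤ) {x σ : ℝ}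
    (hx : x ∈ Set.Icc (1 / 2 : ℝ) (3 / 2)) (hσ : σ ∈ Set.Icc (-1 : ℝ) 1) :
    pairPath g P b c κ x (σ + 4 * l) = (b * c) ^ l • P (chordPoint g κ x σ) := by
  rw [pairPath_add, pairPath]
  have := glue_add h.glue_compat 0 x hσ
  rw [Int.cast_zero, mul_zero, zero_add] at this
  rw [this, pairSegment, clamp_of_mem hx.1 hx.2]
  simp

theorem pairPath_odd (h : PairCloses g P b c κ) (l : ℤ) {x σ : ℝ}
    (hx : x ∈ Set.Icc (1 / 2 : ℝ) (3 / 2)) (hσ : σ ∈ Set.Icc (-1 : ℝ) 1) :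
    pairPath g P b c κ x (2 - σ + 4 * l) = (b * c) ^ l • c • P (chordPoint g κ (4 - x) σ) := by
  rw [pairPath_add, pairPath]
  have := glue_add h.glue_compat 1 x (σ := -σ) ⟨by linarith [hσ.2], by linarith [hσ.1]⟩
  rw [Int.cast_one, mul_one, ← sub_eq_add_neg] at this
  rw [this, pairSegment, clamp_of_mem hx.1 hx.2]
  simp

theorem pairTwist_of_le (ε : ℤ) {z : Disc} (hz : chordHeight g κ z ≤ 1 / 2) :
    pairTwist g P b c κ ε z = P z := if_pos hz

/-- At the four slab edges the shift is `0`, `4ε`, `4ε`, `0`, where `4` is one full turn; `c⁻¹`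
removes the factor carried by outer segments of `pairPath`. -/
theorem pairTwist_of_ge_aux (hg : 2 ≤ g) (h : PairCloses g P b c κ) (ε : ℤ) {z : Disc} :
    (chordHeight g κ z = 1 / 2 → pairPath g P b c κ (chordHeight g κ z)
      (chordParam g κ z + 4 * ε * (chordHeight g κ z - 1 / 2)) = P z) ∧
    (chordHeight g κ z = 3 / 2 → pairPath g P b c κ (chordHeight g κ z)
      (chordParam g κ z + 4 * ε * (chordHeight g κ z - 1 / 2)) = (b * c) ^ ε • P z) ∧
    (chordHeight g κ z = 5 / 2 → c⁻¹ • pairPath g P b c κ (4 - chordHeight g κ z)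
      (2 - chordParam g κ z + 4 * ε * (7 / 2 - chordHeight g κ z)) = (b * c) ^ ε • P z) ∧
    (chordHeight g κ z = 7 / 2 → c⁻¹ • pairPath g P b c κ (4 - chordHeight g κ z)
      (2 - chordParam g κ z + 4 * ε * (7 / 2 - chordHeight g κ z)) = P z) := by
  refine ⟨fun hz => ?_, fun hz => ?_, fun hz => ?_, fun hz => ?_⟩ <;>
    obtain ⟨h1, h2⟩ := chordParam_mem hg κ (z := z) (by linarith) (by linarith) <;>
    rw [hz] at h2 ⊢
  · have := pairPath_even h 0 (x := 1 / 2) (by norm_num) h1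
    rw [h2, zpow_zero, one_smul] at this
    rw [← this]
    congr 1
    push_cast; ring
  · have := pairPath_even h ε (x := 3 / 2) (by norm_num) h1
    rw [h2] at this
    rw [← this]
    congr 1
    ring
  · have e : (4 - 5 / 2 : ℝ) = 3 / 2 := by norm_num
    have e' : (4 - 3 / 2 : ℝ) = 5 / 2 := by norm_num
    have := pairPath_odd h ε (x := 3 / 2) (by norm_num) h1
    rw [e', h2] at this
    rw [inv_smul_eq_iff, smul_comm, ← this, e]
    congr 1
    ring
  · have e : (4 - 7 / 2 : ℝ) = 1 / 2 := by norm_num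
    have e' : (4 - 1 / 2 : ℝ) = 7 / 2 := by norm_num
    have := pairPath_odd h 0 (x := 1 / 2) (by norm_num) h1
    rw [e', h2, zpow_zero, one_smul] at this
    rw [inv_smul_eq_iff, ← this, e]
    congr 1
    push_cast; ring

theorem pairTwist_of_mem_inner (hg : 2 ≤ g) (h : PairCloses g P b c κ) (ε : ℤ) {z : Disc}
    (hz : chordHeight g κ z ∈ Set.Icc (1 / 2 : ℝ) (3 / 2)) :
    pairTwist g P b c κ ε z = pairPath g P b c κ (chordHeight g κ z)
      (chordParam g κ z + 4 * ε * (chordHeight g κ z - 1 / 2)) := by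
  obtain ⟨h1, -, -, -⟩ := pairTwist_of_ge_aux hg h ε (z := z)
  unfold pairTwist
  split_ifs with h5 h6
  · exact (h1 (le_antisymm h5 hz.1)).symm
  · rfl
  all_goals exact absurd hz.2 h6

theorem pairTwist_of_mem_mid (hg : 2 ≤ g) (h : PairCloses g P b c κ) (ε : ℤ) {z : Disc}
    (hz : chordHeight g κ z ∈ Set.Icc (3 / 2 : ℝ) (5 / 2)) :
    pairTwist g P b c κ ε z = (b * c) ^ ε • P z := by
  obtain ⟨-, h2, -, -⟩ := pairTwist_of_ge_aux hg h ε (z := z)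
  obtain ⟨hz1, hz2⟩ := hz
  rcases hz1.eq_or_lt with h5 | h5
  · rw [pairTwist_of_mem_inner hg h ε ⟨by linarith, by linarith⟩, h2 h5.symm]
  · rw [pairTwist, if_neg (by linarith), if_neg (by linarith), if_pos hz2]

theorem pairTwist_of_mem_outer (hg : 2 ≤ g) (h : PairCloses g P b c κ) (ε : ℤ) {z : Disc}
    (hz : chordHeight g κ z ∈ Set.Icc (5 / 2 : ℝ) (7 / 2)) :
    pairTwist g P b c κ ε z = c⁻¹ • pairPath g P b c κ (4 - chordHeight g κ z)
      (2 - chordParam g κ z + 4 * ε * (7 / 2 - chordHeight g κ z)) := by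
  obtain ⟨-, -, h3, -⟩ := pairTwist_of_ge_aux hg h ε (z := z)
  obtain ⟨hz1, hz2⟩ := hz
  rcases hz1.eq_or_lt with h5 | h5
  · rw [pairTwist_of_mem_mid hg h ε ⟨by linarith, by linarith⟩, h3 h5.symm]
  · rw [pairTwist, if_neg (by linarith), if_neg (by linarith), if_neg (by linarith), if_pos hz2]

theorem pairTwist_of_ge (hg : 2 ≤ g) (h : PairCloses g P b c κ) (ε : ℤ) {z : Disc}
    (hz : 7 / 2 ≤ chordHeight g κ z) : pairTwist g P b c κ ε z = P z := by
  obtain ⟨-, -, -, h4⟩ := pairTwist_of_ge_aux hg h ε (z := z)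
  rcases hz.eq_or_lt with h5 | h5
  · rw [pairTwist_of_mem_outer hg h ε ⟨by linarith, by linarith⟩, h4 h5.symm]
  · rw [pairTwist, if_neg (by linarith), if_neg (by linarith), if_neg (by linarith),
      if_neg (by linarith)]

theorem pairTwist_chordPoint_inner (hg : 2 ≤ g) (h : PairCloses g P b c κ) (ε : ℤ) {x σ : ℝ}
    (hx : x ∈ Set.Icc (1 / 2 : ℝ) (3 / 2)) (hσ : σ ∈ Set.Icc (-1 : ℝ) 1) :
    pairTwist g P b c κ ε (chordPoint g κ x σ) =
      pairPath g P b c κ x (σ + 4 * ε * (x - 1 / 2)) := by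
  have hg' : (2 : ℝ) ≤ g := by exact_mod_cast hg
  have h1 : chordHeight g κ (chordPoint g κ x σ) = x :=
    chordHeight_chordPoint hg κ σ (by linarith [hx.1]) (by linarith [hx.2])
  rw [pairTwist_of_mem_inner hg h ε (by rwa [h1]), h1,
    chordParam_chordPoint hg κ hx.1 (by linarith [hx.2]) hσ.1 hσ.2]

theorem pairTwist_chordPoint_outer (hg : 2 ≤ g) (h : PairCloses g P b c κ) (ε : ℤ) {x σ : ℝ}
    (hx : x ∈ Set.Icc (1 / 2 : ℝ) (3 / 2)) (hσ : σ ∈ Set.Icc (-1 : ℝ) 1) :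
    pairTwist g P b c κ ε (chordPoint g κ (4 - x) σ) =
      c⁻¹ • pairPath g P b c κ x (2 - σ + 4 * ε * (x - 1 / 2)) := by
  have hg' : (2 : ℝ) ≤ g := by exact_mod_cast hg
  have h1 : chordHeight g κ (chordPoint g κ (4 - x) σ) = 4 - x :=
    chordHeight_chordPoint hg κ σ (by linarith [hx.2]) (by linarith [hx.1])
  rw [pairTwist_of_mem_outer hg h ε (by rw [h1]; constructor <;> linarith [hx.1, hx.2]), h1,
    chordParam_chordPoint hg κ (by linarith [hx.2]) (by linarith [hx.1]) hσ.1 hσ.2, sub_sub_cancel]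
  congr 2
  ring

theorem continuous_pairTwist [TopologicalSpace X] [ContinuousConstSMul A X] (hg : 2 ≤ g)
    (hP : Continuous P) (h : PairCloses g P b c κ) (ε : ℤ) :
    Continuous (pairTwist g P b c κ ε) := by
  have h1 : Continuous fun u : ℝ × ℝ => pairPath g P b c κ u.1 u.2 :=
    continuous_glue h.glue_compat fun k => by
      unfold pairSegment
      by_cases hk : Even k
      · simp only [if_pos hk]; fun_prop
      · simp only [if_neg hk]; fun_prop
  have h2 := continuous_chordParam hg κ
  have h3 := continuous_chordHeight g κ
  have aux := fun z => pairTwist_of_ge_aux hg h ε (z := z)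
  refine Continuous.if_le hP (Continuous.if_le ?_ (Continuous.if_le (hP.const_smul _)
    (Continuous.if_le (Continuous.const_smul ?_ _) hP h3 continuous_const ?_) h3 continuous_const ?_)
    h3 continuous_const ?_) h3 continuous_const ?_
  · exact h1.comp (f := fun z => (chordHeight g κ z,
      chordParam g κ z + 4 * ε * (chordHeight g κ z - 1 / 2))) (by fun_prop)
  · exact h1.comp (f := fun z => (4 - chordHeight g κ z,
      2 - chordParam g κ z + 4 * ε * (7 / 2 - chordHeight g κ z))) (by fun_prop)
  · exact fun z hz => (aux z).2.2.2 hz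
  · intro z hz
    rw [if_pos (by linarith)]
    exact ((aux z).2.2.1 hz).symm
  · intro z hz
    rw [if_pos (by linarith)]
    exact (aux z).2.1 hz
  · intro z hz
    rw [if_pos (by linarith)]
    exact ((aux z).1 hz).symm

theorem map_pairTwist {S : Type*} {p : X → S} (hp : ∀ (a : A) x, p (a • x) = p x) (P : Disc → X)
    (b c : A) (κ : ℝ) (ε : ℤ) (z : Disc) : p (pairTwist g P b c κ ε z) =
      letI := trivialAction S
      pairTwist g (p ∘ P) (1 : PUnit) 1 κ ε z := by
  have key : ∀ x s, p (pairPath g P b c κ x s) =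
      letI := trivialAction S; pairPath g (p ∘ P) (1 : PUnit) 1 κ x s := by
    intro x s
    simp only [pairPath, glue, pairSegment]
    split_ifs <;> rw [hp] <;> rfl
  unfold pairTwist
  split_ifs
  · rfl
  · exact key _ _
  · rw [hp]; rfl
  · rw [hp, key]; rfl
  · rfl

theorem pairTwist_leftInverse {S : Type*} (hg : 2 ≤ g) {Q : Disc → S}
    {f : S → S} {ε ε' : ℤ} (hε : ε + ε' = 0)
    (h : letI := trivialAction S; PairCloses g Q (1 : PUnit) 1 κ)
    (hf : ∀ z, f (Q z) = letI := trivialAction S; pairTwist g Q (1 : PUnit) 1 κ ε' z) (z : Disc) :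
    f (letI := trivialAction S; pairTwist g Q (1 : PUnit) 1 κ ε z) = Q z := by
  let _ := trivialAction S
  have hsmul : ∀ (u : PUnit) (s : S), u • s = s := fun _ _ => rfl
  have hε' : (ε' : ℝ) = -ε := by
    have : ((ε + ε' : ℤ) : ℝ) = 0 := by rw [hε]; simp
    push_cast at this; linarith
  -- In the path coordinate, `f` rotates each closed curve of the annulus by one amount, on inner
  -- and outer chords alike.
  have key : ∀ x ∈ Set.Icc (1 / 2 : ℝ) (3 / 2), ∀ s,
      f (pairPath g Q (1 : PUnit) 1 κ x s) =
        pairPath g Q (1 : PUnit) 1 κ x (s + 4 * ε' * (x - 1 / 2)) := by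
    intro x hx s
    obtain ⟨k, σ, hσ, hs⟩ := exists_eq_two_mul_add s
    rcases k.even_or_odd' with ⟨l, rfl | rfl⟩
    · have e : s = σ + 4 * (l : ℝ) := by rw [hs]; push_cast; ring
      have e' : σ + 4 * (l : ℝ) + 4 * ε' * (x - 1 / 2) = σ + 4 * ε' * (x - 1 / 2) + 4 * (l : ℝ) := by
        ring
      rw [e, pairPath_even h l hx hσ, hsmul, hf, pairTwist_chordPoint_inner hg h _ hx hσ, e',
        pairPath_add, hsmul]
    · have hσ' : -σ ∈ Set.Icc (-1 : ℝ) 1 := ⟨by linarith [hσ.2], by linarith [hσ.1]⟩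
      have e : s = 2 - -σ + 4 * (l : ℝ) := by rw [hs]; push_cast; ring
      have e' : 2 - -σ + 4 * (l : ℝ) + 4 * ε' * (x - 1 / 2) =
          2 - -σ + 4 * ε' * (x - 1 / 2) + 4 * (l : ℝ) := by
        ring
      rw [e, pairPath_odd h l hx hσ', hsmul, hsmul, hf, pairTwist_chordPoint_outer hg h _ hx hσ', e',
        pairPath_add, hsmul]
  rcases le_total (chordHeight g κ z) (1 / 2) with h1 | h1
  · rw [pairTwist_of_le _ h1, hf, pairTwist_of_le _ h1]
  rcases le_total (chordHeight g κ z) (3 / 2) with h2 | h2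
  · obtain ⟨h6, h7⟩ := chordParam_mem hg κ h1 (by linarith)
    rw [pairTwist_of_mem_inner hg h _ ⟨h1, h2⟩, key _ ⟨h1, h2⟩]
    have := pairPath_even h 0 ⟨h1, h2⟩ h6
    rw [hsmul, h7] at this
    rw [← this]
    congr 1
    rw [hε']; push_cast; ring
  rcases le_total (chordHeight g κ z) (5 / 2) with h3 | h3
  · rw [pairTwist_of_mem_mid hg h _ ⟨h2, h3⟩, hsmul, hf, pairTwist_of_mem_mid hg h _ ⟨h2, h3⟩, hsmul]
  rcases le_total (chordHeight g κ z) (7 / 2) with h4 | h4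
  · obtain ⟨h6, h7⟩ := chordParam_mem hg κ h1 h4
    have hx : 4 - chordHeight g κ z ∈ Set.Icc (1 / 2 : ℝ) (3 / 2) := ⟨by linarith, by linarith⟩
    rw [pairTwist_of_mem_outer hg h _ ⟨h3, h4⟩, hsmul, key _ hx]
    have := pairPath_odd h 0 hx h6
    rw [hsmul, hsmul, sub_sub_cancel, h7] at this
    rw [← this]
    congr 1
    rw [hε']; push_cast; ring
  · rw [pairTwist_of_ge hg h _ h4, hf, pairTwist_of_ge hg h _ h4]

/-- The positions of the sides with respect to the axis through the middle of the side `j + 3`. -/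
theorem sidePoint_pair (j : ℕ) (t : ℝ) :
    sidePoint g j t = chordPoint g (j + 7 / 2) (4 - (t + 1 / 2)) (-1) ∧
    sidePoint g (j + 2) (1 - t) = chordPoint g (j + 7 / 2) (t + 1 / 2) (-1) ∧
    sidePoint g (j + 4) t = chordPoint g (j + 7 / 2) (t + 1 / 2) 1 ∧
    sidePoint g (j + 4 + 2) (1 - t) = chordPoint g (j + 7 / 2) (4 - (t + 1 / 2)) 1 := by
  refine ⟨?_, ?_, ?_, ?_⟩ <;> rw [sidePoint_eq]
  · rw [← boundaryPoint_sub]; congr 1; ring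
  · rw [← boundaryPoint_sub]; congr 1; push_cast; ring
  · rw [← boundaryPoint_add]; congr 1; push_cast; ring
  · rw [← boundaryPoint_add]; congr 1; push_cast; ring

theorem chordHeight_sidePoint_pair_low (hg : 2 ≤ g) (j : ℕ) {t : ℝ} (ht : t ∈ Set.Icc (0 : ℝ) 1) :
    chordHeight g (j + 7 / 2) (sidePoint g (j + 3) t) ≤ 1 / 2 := by
  have hg' : (2 : ℝ) ≤ g := by exact_mod_cast hg
  have h1 : |((j + 3 : ℕ) : ℝ) + t - (j + 7 / 2)| ≤ 1 / 2 := by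
    rw [abs_le]; push_cast; constructor <;> linarith [ht.1, ht.2]
  rw [sidePoint_eq, chordHeight_boundaryPoint hg (by linarith)]
  exact h1

theorem chordHeight_sidePoint_pair_mid (hg : 2 ≤ g) (j : ℕ) {t : ℝ} (ht : t ∈ Set.Icc (0 : ℝ) 1) :
    chordHeight g (j + 7 / 2) (sidePoint g (j + 1) t) ∈ Set.Icc (3 / 2 : ℝ) (5 / 2) ∧
    chordHeight g (j + 7 / 2) (sidePoint g (j + 5) t) ∈ Set.Icc (3 / 2 : ℝ) (5 / 2) := by
  have hg' : (2 : ℝ) ≤ g := by exact_mod_cast hg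
  obtain ⟨ht0, ht1⟩ := ht
  have h1 : |((j + 1 : ℕ) : ℝ) + t - (j + 7 / 2)| = 5 / 2 - t := by
    rw [abs_of_nonpos] <;> push_cast <;> linarith
  have h2 : |((j + 5 : ℕ) : ℝ) + t - (j + 7 / 2)| = 3 / 2 + t := by
    rw [abs_of_nonneg] <;> push_cast <;> linarith
  constructor
  · rw [sidePoint_eq, chordHeight_boundaryPoint hg (by linarith), h1]
    constructor <;> linarith
  · rw [sidePoint_eq, chordHeight_boundaryPoint hg (by linarith), h2]
    constructor <;> linarith

theorem chordHeight_sidePoint_pair_far (hg : 2 ≤ g) {j k : ℕ} (hj : j + 6 < 4 * g) (hk : k < 4 * g)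
    (h : k < j ∨ j + 6 < k) {t : ℝ} (ht : t ∈ Set.Icc (0 : ℝ) 1) :
    7 / 2 ≤ chordHeight g (j + 7 / 2) (sidePoint g k t) := by
  rw [sidePoint_eq]
  have hj' : (j : ℝ) + 7 ≤ 4 * g := by exact_mod_cast hj
  have hk' : (k : ℝ) + 1 ≤ 4 * g := by exact_mod_cast hk
  have hj0 : (0 : ℝ) ≤ j := j.cast_nonneg
  have hk0 : (0 : ℝ) ≤ k := k.cast_nonneg
  obtain ⟨ht0, ht1⟩ := ht
  apply le_chordHeight_boundaryPoint hg _ _ (by norm_num)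
  · rcases h with h | h
    · have : (k : ℝ) + 1 ≤ j := by exact_mod_cast h
      rw [abs_of_nonpos (by linarith)]; linarith
    · have : (j : ℝ) + 7 ≤ k := by exact_mod_cast h
      rw [abs_of_nonneg (by linarith)]; linarith
  · rw [abs_le]; constructor <;> linarith

theorem SidesPaired.pairCloses {j : ℕ} (h : SidesPaired g P j b) (h' : SidesPaired g P (j + 4) c) :
    PairCloses g P b c (j + 7 / 2) := by
  intro x hx
  have ht : x - 1 / 2 ∈ Set.Icc (0 : ℝ) 1 := ⟨by linarith [hx.1], by linarith [hx.2]⟩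
  obtain ⟨e1, e2, e3, e4⟩ := sidePoint_pair (g := g) j (x - 1 / 2)
  rw [sub_add_cancel] at e1 e2 e3 e4
  have h1 := h _ ht
  have h2 := h' _ ht
  rw [e1, e2] at h1
  rw [e3, e4] at h2
  exact ⟨h1, h2⟩

theorem SidesPaired.pairTwist_self {j : ℕ} (hg : 2 ≤ g) (h : SidesPaired g P j b)
    (h' : SidesPaired g P (j + 4) c) (ε : ℤ) :
    SidesPaired g (pairTwist g P b c (j + 7 / 2) ε) j b ∧
    SidesPaired g (pairTwist g P b c (j + 7 / 2) ε) (j + 4) c := by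
  have hc := h.pairCloses h'
  refine ⟨fun t ht => ?_, fun t ht => ?_⟩ <;>
    have hx : t + 1 / 2 ∈ Set.Icc (1 / 2 : ℝ) (3 / 2) := ⟨by linarith [ht.1], by linarith [ht.2]⟩ <;>
    obtain ⟨e1, e2, e3, e4⟩ := sidePoint_pair (g := g) j t
  · rw [e1, e2, pairTwist_chordPoint_outer hg hc ε hx (by norm_num),
      pairTwist_chordPoint_inner hg hc ε hx (by norm_num)]
    have : 2 - (-1) + 4 * (ε : ℝ) * (t + 1 / 2 - 1 / 2) =
      -1 + 4 * (ε : ℝ) * (t + 1 / 2 - 1 / 2) + 4 * ((1 : ℤ) : ℝ) := by push_cast; ring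
    rw [this, pairPath_add, smul_smul, zpow_one, mul_comm b c, inv_mul_cancel_left]
  · rw [e3, e4, pairTwist_chordPoint_outer hg hc ε hx (by norm_num),
      pairTwist_chordPoint_inner hg hc ε hx (by norm_num), smul_inv_smul]
    congr 1
    ring

theorem SidesPaired.pairTwist_far {j : ℕ} (hg : 2 ≤ g) (h : SidesPaired g P j b)
    (h' : SidesPaired g P (j + 4) c) (ε : ℤ) {k : ℕ} {d : A}
    (hk : SidesPaired g P k d) (hj : j + 6 < 4 * g) (hk' : k + 2 < 4 * g) (hjk : k + 2 < j ∨ j + 6 < k) :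
    SidesPaired g (pairTwist g P b c (j + 7 / 2) ε) k d := by
  have hc := h.pairCloses h'
  intro t ht
  rw [pairTwist_of_ge hg hc ε (chordHeight_sidePoint_pair_far hg hj (by omega) (by omega) ht),
    pairTwist_of_ge hg hc ε
      (chordHeight_sidePoint_pair_far hg hj (by omega) (by omega) (one_sub_mem_Icc ht)), hk t ht]

/-- Side `j + 3` is in the fixed cap, and its partner `j + 5` lies between the slabs, where the
twist is `(b * c) ^ ε`. -/
theorem SidesPaired.pairTwist_low {j : ℕ} (hg : 2 ≤ g) (h : SidesPaired g P j b)
    (h' : SidesPaired g P (j + 4) c) (ε : ℤ) {d : A} (hk : SidesPaired g P (j + 3) d) :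
    SidesPaired g (pairTwist g P b c (j + 7 / 2) ε) (j + 3) (d * (b * c) ^ (-ε)) := by
  have hc := h.pairCloses h'
  intro t ht
  rw [pairTwist_of_le ε (chordHeight_sidePoint_pair_low hg j ht),
    pairTwist_of_mem_mid hg hc ε (chordHeight_sidePoint_pair_mid hg j (one_sub_mem_Icc ht)).2,
    hk t ht, smul_smul, mul_assoc, ← zpow_add]
  simp

/-- Side `j` is in the fixed region beyond the outer slab, and its partner `j + 2` lies between the
slabs. -/
theorem SidesPaired.pairTwist_high {j : ℕ} (hg : 2 ≤ g) (h : SidesPaired g P (j + 1) b)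
    (h' : SidesPaired g P (j + 1 + 4) c) (ε : ℤ) {d : A} (hk : SidesPaired g P j d)
    (hj : j + 7 < 4 * g) :
    SidesPaired g (pairTwist g P b c ((j + 1 : ℕ) + 7 / 2) ε) j (d * (b * c) ^ (-ε)) := by
  have hc := h.pairCloses h'
  intro t ht
  rw [pairTwist_of_ge hg hc ε
      (chordHeight_sidePoint_pair_far hg (by omega) (by omega) (by omega) ht),
    pairTwist_of_mem_mid hg hc ε
      (chordHeight_sidePoint_pair_mid hg (j + 1) (one_sub_mem_Icc ht)).1,
    hk t ht, smul_smul, mul_assoc, ← zpow_add]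
  simp

/-- The effect on the periods of a Dehn twist in the annulus crossing the sides `b i` and
`b (i + 1)`. -/
theorem IsPeriodLift.pairTwist [TopologicalSpace X] [ContinuousConstSMul A X] (hg : 2 ≤ g)
    {a b : Fin g → A} (h : IsPeriodLift P a b) {i i' : Fin g} (hi : (i' : ℕ) = i + 1) (ε : ℤ) :
    IsPeriodLift (pairTwist g P (b i) (b i') ((4 * i + 1 : ℕ) + 7 / 2) ε)
      (Function.update (Function.update a i (a i * (b i * b i') ^ (-ε))) i'
        (a i' * (b i * b i') ^ (-ε))) b := by
  rw [isPeriodLift_iff] at h ⊢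
  obtain ⟨h0, h1, h2⟩ := h
  have hi0 := i.2
  have hi1 := i'.2
  have hii : i ≠ i' := fun h => by rw [h] at hi; omega
  have hb := h2 i
  have hb' : SidesPaired g P (4 * i + 1 + 4) (b i') := by
    have := h2 i'
    rwa [hi, show 4 * ((i : ℕ) + 1) + 1 = 4 * i + 1 + 4 by ring] at this
  refine ⟨continuous_pairTwist hg h0 (hb.pairCloses hb') ε, fun k => ?_, fun k => ?_⟩
  · have hk := k.2
    rcases eq_or_ne k i' with rfl | hki'
    · rw [Function.update_self]
      have h3 := h1 k
      rw [hi] at h3 ⊢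
      exact hb.pairTwist_low hg hb' ε h3
    rw [Function.update_of_ne hki']
    rcases eq_or_ne k i with rfl | hki
    · rw [Function.update_self]
      exact hb.pairTwist_high hg hb' ε (h1 k) (by omega)
    · rw [Function.update_of_ne hki]
      have := fin_lt_or_lt_of_ne hki
      have := fin_lt_or_lt_of_ne hki'
      exact hb.pairTwist_far hg hb' ε (h1 k) (by omega) (by omega) (by omega)
  · have hk := k.2
    rcases eq_or_ne k i' with rfl | hki'
    · have h3 := (hb.pairTwist_self hg hb' ε).2
      rwa [show 4 * (i : ℕ) + 1 + 4 = 4 * k + 1 by omega] at h3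
    rcases eq_or_ne k i with rfl | hki
    · exact (hb.pairTwist_self hg hb' ε).1
    · have := fin_lt_or_lt_of_ne hki
      have := fin_lt_or_lt_of_ne hki'
      exact hb.pairTwist_far hg hb' ε (h2 k) (by omega) (by omega) (by omega)

end PairTwist

/-! ### The twists as homeomorphisms of the surface -/

section Homeomorph

variable {g : ℕ}

/-- A family of mutually inverse maps given on the polygon consists of homeomorphisms of the
surface. -/
theorem exists_homeomorph_of_inverse {F : ℤ → Disc → StandardSurface g}
    (hc : ∀ ε, Continuous (F ε)) (hr : ∀ ε z w, SidePairing g z w → F ε z = F ε w)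
    (hinv : ∀ (ε ε' : ℤ) (f : StandardSurface g → StandardSurface g), ε + ε' = 0 →
      (∀ z, f (Quot.mk _ z) = F ε' z) → ∀ z, f (F ε z) = Quot.mk _ z) (ε : ℤ) :
    ∃ f : StandardSurface g ≃ₜ StandardSurface g, ∀ z, f (Quot.mk _ z) = F ε z := by
  refine ⟨⟨⟨Quot.lift (F ε) (hr ε), Quot.lift (F (-ε)) (hr (-ε)), ?_, ?_⟩,
    continuous_quot_lift _ (hc ε), continuous_quot_lift _ (hc (-ε))⟩, fun z => rfl⟩
  · rintro ⟨z⟩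
    exact hinv ε (-ε) _ (by ring) (fun w => rfl) z
  · rintro ⟨z⟩
    exact hinv (-ε) ε _ (by ring) (fun w => rfl) z

theorem continuousConstSMul_trivialAction (Z : Type*) [TopologicalSpace Z] :
    letI := trivialAction Z; ContinuousConstSMul PUnit.{1} Z :=
  letI := trivialAction Z
  ⟨fun _ => continuous_id⟩

/-- For the trivial group a period lift is a map respecting the side pairings, so the results on
twisted lifts show that the twists descend to the surface. -/
theorem isPeriodLift_mk : letI := trivialAction (StandardSurface g)
    IsPeriodLift (Quot.mk (SidePairing g)) (1 : Fin g → PUnit) 1 :=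
  letI := trivialAction (StandardSurface g)
  ⟨continuous_quot_mk, fun i t ht => Quot.sound (SidePairing.a i t ht),
    fun i t ht => Quot.sound (SidePairing.b i t ht)⟩

theorem eq_of_isPeriodLift_trivial {F : Disc → StandardSurface g} {a b : Fin g → PUnit}
    (h : letI := trivialAction (StandardSurface g); IsPeriodLift F a b) {z w : Disc}
    (hzw : SidePairing g z w) : F z = F w := by
  cases hzw with
  | a i t ht => exact h.2 i t ht
  | b i t ht => exact h.3 i t ht

theorem exists_homeomorph_slabTwist_a (hg : 2 ≤ g) (i : Fin g) (ε : ℤ) :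
    ∃ f : StandardSurface g ≃ₜ StandardSurface g, ∀ z, f (Quot.mk _ z) =
      letI := trivialAction (StandardSurface g)
      slabTwist g (Quot.mk (SidePairing g)) (1 : PUnit) ((4 * i : ℕ) + 3 / 2) ε z := by
  let _ := trivialAction (StandardSurface g)
  have := continuousConstSMul_trivialAction (StandardSurface g)
  have h := fun ε => (isPeriodLift_mk (g := g)).slabTwist_a hg i ε
  exact exists_homeomorph_of_inverse (fun ε => (h ε).continuous)
    (fun ε z w hzw => eq_of_isPeriodLift_trivial (h ε) hzw)
    (fun ε ε' f hε hf => slabTwist_leftInverse hg hε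
      (SidesPaired.slabCloses ((isPeriodLift_iff.1 isPeriodLift_mk).2.1 i)) hf) ε

theorem exists_homeomorph_slabTwist_b (hg : 2 ≤ g) (i : Fin g) (ε : ℤ) :
    ∃ f : StandardSurface g ≃ₜ StandardSurface g, ∀ z, f (Quot.mk _ z) =
      letI := trivialAction (StandardSurface g)
      slabTwist g (Quot.mk (SidePairing g)) (1 : PUnit) ((4 * i + 1 : ℕ) + 3 / 2) ε z := by
  let _ := trivialAction (StandardSurface g)
  have := continuousConstSMul_trivialAction (StandardSurface g)
  have h := fun ε => (isPeriodLift_mk (g := g)).slabTwist_b hg i ε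
  exact exists_homeomorph_of_inverse (fun ε => (h ε).continuous)
    (fun ε z w hzw => eq_of_isPeriodLift_trivial (h ε) hzw)
    (fun ε ε' f hε hf => slabTwist_leftInverse hg hε
      (SidesPaired.slabCloses ((isPeriodLift_iff.1 isPeriodLift_mk).2.2 i)) hf) ε

theorem exists_homeomorph_pairTwist (hg : 2 ≤ g) {i i' : Fin g} (hi : (i' : ℕ) = i + 1) (ε : ℤ) :
    ∃ f : StandardSurface g ≃ₜ StandardSurface g, ∀ z, f (Quot.mk _ z) =
      letI := trivialAction (StandardSurface g)
      pairTwist g (Quot.mk (SidePairing g)) (1 : PUnit) 1 ((4 * i + 1 : ℕ) + 7 / 2) ε z := by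
  let _ := trivialAction (StandardSurface g)
  have := continuousConstSMul_trivialAction (StandardSurface g)
  have h := fun ε => (isPeriodLift_mk (g := g)).pairTwist hg hi ε
  have hb := (isPeriodLift_iff.1 (isPeriodLift_mk (g := g))).2.2 i'
  rw [hi, show 4 * ((i : ℕ) + 1) + 1 = 4 * i + 1 + 4 by ring] at hb
  exact exists_homeomorph_of_inverse (fun ε => (h ε).continuous)
    (fun ε z w hzw => eq_of_isPeriodLift_trivial (h ε) hzw)
    (fun ε ε' f hε hf => pairTwist_leftInverse hg hε
      (SidesPaired.pairCloses ((isPeriodLift_iff.1 isPeriodLift_mk).2.2 i) hb) hf) ε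

end Homeomorph

/-! ### A simple closed curve crossing the first pair of sides -/

section Curve

variable {g : ℕ}

/-- Only points of norm one are paired, so being equal to `z` is a predicate that descends to the
quotient. -/
theorem eq_of_mk_eq_of_norm_lt_one {z w : Disc} (hz : ‖(z : ℂ)‖ < 1)
    (h : (Quot.mk _ z : StandardSurface g) = Quot.mk _ w) : z = w := by
  have hs : ∀ j t, sidePoint g j t ≠ z := fun j t h => by
    rw [← h, sidePoint, Circle.norm_coe] at hz
    exact lt_irrefl _ hz
  have key : ∀ u v, SidePairing g u v → (u = z) = (v = z) := by
    intro u v huv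
    cases huv <;> exact propext ⟨fun h => absurd h (hs _ _), fun h => absurd h (hs _ _)⟩
  have := congrArg (Quot.lift (fun u => u = z) key) h
  exact (cast this rfl : w = z).symm

theorem norm_chordPoint_lt_one (hg : 2 ≤ g) (κ : ℝ) {σ : ℝ} (h1 : -1 < σ) (h2 : σ < 1) :
    ‖(chordPoint g κ 1 σ : ℂ)‖ < 1 := by
  have hs := sin_clamp_pos hg 1
  rw [clamp_of_mem (by norm_num) (by norm_num)] at hs
  have h3 := Real.sin_sq_add_cos_sq (2 * Real.pi * 1 / (4 * g))
  have h4 : σ ^ 2 < 1 := by nlinarith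
  rw [chordPoint, norm_mul, Circle.norm_coe, one_mul, Complex.norm_add_mul_I,
    clamp_of_mem h1.le h2.le, Real.sqrt_lt' one_pos]
  nlinarith [pow_pos hs 2]

/-- The closed curve formed by the middle chord between the first and the third side is simple. -/
theorem exists_injective_slabPath (hg : 2 ≤ g) :
    ∃ γ : C(Circle, StandardSurface g), Function.Injective γ ∧ ∀ t, γ (Circle.exp t) =
      letI := trivialAction (StandardSurface g)
      slabPath g (Quot.mk (SidePairing g)) (1 : PUnit) ((4 * 0 : ℕ) + 3 / 2) 1 (t / Real.pi) := by
  let _ := trivialAction (StandardSurface g)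
  have := continuousConstSMul_trivialAction (StandardSurface g)
  have hsmul : ∀ (u : PUnit.{1}) (s : StandardSurface g), u • s = s := fun _ _ => rfl
  have hπ := Real.pi_pos
  have hcl : SlabCloses g (Quot.mk (SidePairing g)) (1 : PUnit) ((4 * 0 : ℕ) + 3 / 2) :=
    SidesPaired.slabCloses ((isPeriodLift_iff.1 isPeriodLift_mk).2.1 ⟨0, by omega⟩)
  have hx : (1 : ℝ) ∈ Set.Icc (1 / 2 : ℝ) (3 / 2) := by norm_num
  have hc : Continuous fun u : ℝ × ℝ =>
      slabPath g (Quot.mk (SidePairing g)) (1 : PUnit) ((4 * 0 : ℕ) + 3 / 2) u.1 u.2 :=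
    continuous_slabPath continuous_quot_mk hcl
  obtain ⟨γ, hγ⟩ := exists_circleMap_of_periodic (f := fun t =>
    slabPath g (Quot.mk (SidePairing g)) (1 : PUnit) ((4 * 0 : ℕ) + 3 / 2) 1 (t / Real.pi))
    (hc.comp (f := fun t : ℝ => ((1 : ℝ), t / Real.pi)) (by fun_prop)) (by
      intro t
      have : (t + 2 * Real.pi) / Real.pi = t / Real.pi + 2 * ((1 : ℤ) : ℝ) := by
        push_cast; field_simp
      simp only [this, slabPath_add, hsmul])
  refine ⟨γ, ?_, hγ⟩
  have hform : ∀ σ ∈ Set.Icc (-1 : ℝ) 1,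
      γ (Circle.exp (Real.pi * σ)) = Quot.mk _ (chordPoint g ((4 * 0 : ℕ) + 3 / 2) 1 σ) := by
    intro σ hσ
    have := slabPath_eq hcl 0 hx hσ
    rw [show 2 * ((0 : ℤ) : ℝ) + σ = σ by simp, hsmul] at this
    rw [hγ, mul_div_cancel_left₀ _ hπ.ne', this]
  -- The value `1` is excluded because it names the same point of the circle as `-1`.
  have hrep : ∀ u : Circle, ∃ σ ∈ Set.Icc (-1 : ℝ) 1, σ ≠ 1 ∧ Circle.exp (Real.pi * σ) = u := by
    intro u
    obtain ⟨t, rfl⟩ := Circle.exp_surjective u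
    refine ⟨t / Real.pi - 2 * ⌊(t / Real.pi + 1) / 2⌋, ⟨?_, ?_⟩, ?_, ?_⟩
    · linarith [Int.floor_le ((t / Real.pi + 1) / 2)]
    · linarith [Int.lt_floor_add_one ((t / Real.pi + 1) / 2)]
    · intro h
      linarith [Int.lt_floor_add_one ((t / Real.pi + 1) / 2)]
    · rw [Circle.exp_eq_exp]
      refine ⟨-⌊(t / Real.pi + 1) / 2⌋, ?_⟩
      push_cast
      field_simp
      ring
  have hint : ∀ σ ∈ Set.Icc (-1 : ℝ) 1, ∀ τ ∈ Set.Icc (-1 : ℝ) 1, σ ≠ 1 → σ ≠ -1 →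
      (Quot.mk _ (chordPoint g ((4 * 0 : ℕ) + 3 / 2) 1 σ) : StandardSurface g) =
        Quot.mk _ (chordPoint g ((4 * 0 : ℕ) + 3 / 2) 1 τ) → σ = τ := by
    intro σ hσ τ hτ h1 h2 h
    have := eq_of_mk_eq_of_norm_lt_one (norm_chordPoint_lt_one hg _
      (lt_of_le_of_ne hσ.1 h2.symm) (lt_of_le_of_ne hσ.2 h1)) h
    have := congrArg (chordParam g ((4 * 0 : ℕ) + 3 / 2)) this
    rwa [chordParam_chordPoint hg _ (by norm_num) (by norm_num) hσ.1 hσ.2,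
      chordParam_chordPoint hg _ (by norm_num) (by norm_num) hτ.1 hτ.2] at this
  intro u v huv
  obtain ⟨σ, hσ, hσ1, rfl⟩ := hrep u
  obtain ⟨τ, hτ, hτ1, rfl⟩ := hrep v
  rw [hform σ hσ, hform τ hτ] at huv
  by_cases h1 : σ = -1
  · by_cases h2 : τ = -1
    · rw [h1, h2]
    · rw [hint τ hτ σ hσ hτ1 h2 huv.symm]
  · rw [hint σ hσ τ hτ hσ1 h1 huv]

end Curve

/-! ### Elevation degrees under homeomorphisms of the base -/

section Degrees

theorem isElevation_comp_iff {X S T : Type*} [TopologicalSpace X] [TopologicalSpace S]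
    [TopologicalSpace T] (p : X → S) (f : S ≃ₜ T) (γ : C(Circle, T)) (k : ℕ) (δ : C(Circle, X)) :
    IsElevation (f ∘ p) γ k δ ↔ IsElevation p ((f.symm : C(T, S)).comp γ) k δ := by
  constructor
  · intro h
    exact ⟨h.1, fun z => (f.symm_apply_eq.2 (h.2 z).symm).symm, h.3⟩
  · intro h
    exact ⟨h.1, fun z => (f.symm_apply_eq.1 (h.2 z).symm).symm, h.3⟩

theorem minElevationDegree_comp {X S T : Type*} [TopologicalSpace X] [TopologicalSpace S]
    [TopologicalSpace T] (p : X → S) (f : S ≃ₜ T) (γ : C(Circle, T)) :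
    minElevationDegree (f ∘ p) γ = minElevationDegree p ((f.symm : C(T, S)).comp γ) := by
  unfold minElevationDegree
  simp only [isElevation_comp_iff]

/-- The covers `p` and `q` have the same least elevation degrees of simple closed curves. -/
def SameDegrees {X Y S : Type*} [TopologicalSpace X] [TopologicalSpace Y] [TopologicalSpace S]
    (p : X → S) (q : Y → S) : Prop :=
  ∀ γ : C(Circle, S), Function.Injective γ → minElevationDegree p γ = minElevationDegree q γ

theorem SameDegrees.comp {X Y S T : Type*} [TopologicalSpace X] [TopologicalSpace Y]
    [TopologicalSpace S] [TopologicalSpace T] {p : X → S} {q : Y → S} (h : SameDegrees p q)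
    (f : S ≃ₜ T) : SameDegrees (f ∘ p) (f ∘ q) := by
  intro γ hγ
  rw [minElevationDegree_comp, minElevationDegree_comp]
  exact h _ (f.symm.injective.comp hγ)

end Degrees

/-! ### Change of periods as change of coordinates -/

section PeriodProd

variable {A : Type*} [CommGroup A] {g : ℕ}

/-- Collecting powers of `a i` turns a change of periods into the dual transvection of the
coordinates. -/
theorem periodProd_update_right (a b : Fin g → A) (m n : Fin g → ℤ) (i : Fin g) (ε : ℤ) :
    periodProd a (Function.update b i (b i * a i ^ ε)) m n =
      periodProd a b (Function.update m i (m i + ε * n i)) n := by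
  refine Finset.prod_congr rfl fun j _ => ?_
  rcases eq_or_ne j i with rfl | h
  · simp only [Function.update_self, mul_zpow, zpow_add, zpow_mul]
    rw [mul_comm (b j ^ n j), mul_assoc]
  · simp only [Function.update_of_ne h]

theorem periodProd_update_left (a b : Fin g → A) (m n : Fin g → ℤ) (i : Fin g) (ε : ℤ) :
    periodProd (Function.update a i (a i * b i ^ ε)) b m n =
      periodProd a b m (Function.update n i (n i + ε * m i)) := by
  refine Finset.prod_congr rfl fun j _ => ?_
  rcases eq_or_ne j i with rfl | h
  · simp only [Function.update_self, mul_zpow, zpow_add, zpow_mul]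
    rw [mul_assoc, mul_comm (b j ^ n j)]
  · simp only [Function.update_of_ne h]

theorem periodProd_update_a (a b : Fin g → A) (m n : Fin g → ℤ) (i : Fin g) (c : A) :
    periodProd (Function.update a i (a i * c)) b m n = periodProd a b m n * c ^ m i := by
  have : c ^ m i = ∏ j, Function.update (1 : Fin g → A) i (c ^ m i) j := by
    rw [Finset.prod_update_of_mem (Finset.mem_univ i)]; simp
  rw [this, periodProd, periodProd, ← Finset.prod_mul_distrib]
  refine Finset.prod_congr rfl fun j _ => ?_
  rcases eq_or_ne j i with rfl | h
  · simp only [Function.update_self, mul_zpow]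
    rw [mul_right_comm]
  · simp [Function.update_of_ne h]

theorem periodProd_update_n (a b : Fin g → A) (m n : Fin g → ℤ) (i : Fin g) (k : ℤ) :
    periodProd a b m (Function.update n i (n i + k)) = periodProd a b m n * b i ^ k := by
  have : b i ^ k = ∏ j, Function.update (1 : Fin g → A) i (b i ^ k) j := by
    rw [Finset.prod_update_of_mem (Finset.mem_univ i)]; simp
  rw [this, periodProd, periodProd, ← Finset.prod_mul_distrib]
  refine Finset.prod_congr rfl fun j _ => ?_
  rcases eq_or_ne j i with rfl | h
  · simp only [Function.update_self, zpow_add, mul_assoc]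
  · simp [Function.update_of_ne h]

theorem periodProd_update_pair (a b : Fin g → A) (m n : Fin g → ℤ) {i j : Fin g} (hij : j ≠ i)
    (ε : ℤ) : periodProd (Function.update (Function.update a i (a i * (b i * b j) ^ ε)) j
        (a j * (b i * b j) ^ ε)) b m n =
      periodProd a b m (Function.update (Function.update n i (n i + ε * (m i + m j))) j
        (n j + ε * (m i + m j))) := by
  have h1 := periodProd_update_a (Function.update a i (a i * (b i * b j) ^ ε)) b m n j
    ((b i * b j) ^ ε)
  have h2 := periodProd_update_n a b m (Function.update n i (n i + ε * (m i + m j))) j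
    (ε * (m i + m j))
  rw [Function.update_of_ne hij] at h1 h2
  rw [h1, h2, periodProd_update_a, periodProd_update_n, mul_assoc, mul_assoc, ← zpow_mul,
    ← zpow_mul, ← zpow_add, ← mul_add, mul_zpow]

theorem periodProd_single (a b : Fin g → A) (i : Fin g) (d : ℤ) :
    periodProd a b (Pi.single i d) 0 = a i ^ d := by
  rw [periodProd, Finset.prod_eq_single i] <;> simp +contextual

end PeriodProd

/-! ### Elevation degrees determine the kernel -/

section Main

universe u v w x

variable {g : ℕ} {X : Type u} {Y : Type v} [TopologicalSpace X] [TopologicalSpace Y]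
  {A : Type w} {B : Type x} [CommGroup A] [CommGroup B] [MulAction A X] [MulAction B Y]

/-- The map `P` is a lift of the projection of the polygon along the cover `p`, with periods `a`
and `b`. -/
structure HasPeriods (p : X → StandardSurface g) (P : Disc → X) (a b : Fin g → A) : Prop where
  torsor : IsTorsorCover A p
  lift : IsPeriodLift P a b
  proj : ∀ z, p (P z) = Quot.mk _ z

/-- Least elevation degrees of simple closed curves decide whether the element with coordinates
`m`, `n` with respect to the periods is trivial. -/
def DegreesDetermine (A : Type w) (B : Type x) (X : Type u) (Y : Type v) [TopologicalSpace X]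
    [TopologicalSpace Y] [CommGroup A] [CommGroup B] [MulAction A X] [MulAction B Y]
    (m n : Fin g → ℤ) : Prop :=
  ∀ (p : X → StandardSurface g) (q : Y → StandardSurface g) (P : Disc → X) (Q : Disc → Y)
    (a b : Fin g → A) (a' b' : Fin g → B), HasPeriods p P a b → HasPeriods q Q a' b' →
    SameDegrees p q → (periodProd a b m n = 1 ↔ periodProd a' b' m n = 1)

/-- Only the projection and the polygon lift change; the total space and its group action stay the
same, so the induction can keep `A` and `X` fixed. -/
theorem HasPeriods.homeomorph_symm_comp {p : X → StandardSurface g} {P P' : Disc → X}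
    {a b a' b' : Fin g → A} (h : HasPeriods p P a b) (f : StandardSurface g ≃ₜ StandardSurface g)
    (hP' : IsPeriodLift P' a' b') (hproj : ∀ z, p (P' z) = f (Quot.mk _ z)) :
    HasPeriods (f.symm ∘ p) P' a' b' :=
  ⟨h.torsor.homeomorph_comp f.symm, hP', fun z => f.symm_apply_eq.2 (hproj z)⟩

theorem HasPeriods.comp_eq_mk {p : X → StandardSurface g} {P : Disc → X} {a b : Fin g → A}
    (h : HasPeriods p P a b) : p ∘ P = Quot.mk (SidePairing g) := funext h.proj

/-- The curve is chosen on the surface, independently of any cover, so one curve tests both covers.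
-/
theorem HasPeriods.exists_minElevationDegree_eq [ContinuousConstSMul A X]
    [ContinuousConstSMul B Y] (hg : 2 ≤ g) :
    ∃ γ : C(Circle, StandardSurface g), Function.Injective γ ∧
      (∀ (p : X → StandardSurface g) (P : Disc → X) (a b : Fin g → A), HasPeriods p P a b →
        minElevationDegree p γ = orderOf (a ⟨0, by omega⟩)) ∧
      ∀ (p : Y → StandardSurface g) (P : Disc → Y) (a b : Fin g → B), HasPeriods p P a b →
        minElevationDegree p γ = orderOf (a ⟨0, by omega⟩) := by
  obtain ⟨γ, hinj, hγ⟩ := exists_injective_slabPath hg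
  refine ⟨γ, hinj, ?_, ?_⟩ <;>
  · intro p P a b h
    have hcl := SidesPaired.slabCloses ((isPeriodLift_iff.1 h.lift).2.1 ⟨0, by omega⟩)
    -- One turn multiplies the lift by the inverse of the period, which has the same order.
    rw [← orderOf_inv]
    refine h.torsor.minElevationDegree_eq_orderOf γ
      (Γ := fun t => slabPath g P (a ⟨0, by omega⟩) ((4 * 0 : ℕ) + 3 / 2) 1 (t / Real.pi)) ?_ ?_ ?_
    · exact (continuous_slabPath h.lift.continuous hcl).comp
        (f := fun t : ℝ => ((1 : ℝ), t / Real.pi)) (by fun_prop)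
    · intro t
      rw [map_slabPath h.torsor.map_smul, h.comp_eq_mk, hγ]
    · have e : 2 * Real.pi / Real.pi = 0 / Real.pi + 2 * ((1 : ℤ) : ℝ) := by
        have := Real.pi_ne_zero
        push_cast; field_simp; ring
      simp only [e, slabPath_add, zpow_neg_one]

/-- `DegreesDetermine` quantifies over all covers and lifts, so the induction hypothesis applies to
the covers composed with an inverse twist. -/
theorem degreesDetermine [ContinuousConstSMul A X] [ContinuousConstSMul B Y] (hg : 2 ≤ g)
    (m n : Fin g → ℤ) : DegreesDetermine A B X Y m n := by
  refine transvection_induction (by omega) (G := DegreesDetermine A B X Y) ?_ ?_ ?_ ?_ m n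
  · intro k i m n ih p q P Q a b a' b' hp hq hpq
    obtain ⟨f, hf⟩ := exists_homeomorph_slabTwist_a hg i k
    have := ih _ _ _ _ _ _ _ _
      (hp.homeomorph_symm_comp f (hp.lift.slabTwist_a hg i k) fun z => by
        rw [map_slabTwist hp.torsor.map_smul, hp.comp_eq_mk, hf])
      (hq.homeomorph_symm_comp f (hq.lift.slabTwist_a hg i k) fun z => by
        rw [map_slabTwist hq.torsor.map_smul, hq.comp_eq_mk, hf]) (hpq.comp f.symm)
    rwa [periodProd_update_right, periodProd_update_right] at this
  · intro k i m n ih p q P Q a b a' b' hp hq hpq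
    -- The twist across `b i` changes `a i` by the exponent `-ε`, hence `-k`.
    obtain ⟨f, hf⟩ := exists_homeomorph_slabTwist_b hg i (-k)
    have := ih _ _ _ _ _ _ _ _
      (hp.homeomorph_symm_comp f (hp.lift.slabTwist_b hg i (-k)) fun z => by
        rw [map_slabTwist hp.torsor.map_smul, hp.comp_eq_mk, hf])
      (hq.homeomorph_symm_comp f (hq.lift.slabTwist_b hg i (-k)) fun z => by
        rw [map_slabTwist hq.torsor.map_smul, hq.comp_eq_mk, hf]) (hpq.comp f.symm)
    rwa [periodProd_update_left, periodProd_update_left, neg_neg] at this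
  · intro k i j hij m n ih p q P Q a b a' b' hp hq hpq
    obtain ⟨f, hf⟩ := exists_homeomorph_pairTwist hg hij (-k)
    have hji : j ≠ i := fun h => by rw [h] at hij; omega
    have := ih _ _ _ _ _ _ _ _
      (hp.homeomorph_symm_comp f (hp.lift.pairTwist hg hij (-k)) fun z => by
        rw [map_pairTwist hp.torsor.map_smul, hp.comp_eq_mk, hf])
      (hq.homeomorph_symm_comp f (hq.lift.pairTwist hg hij (-k)) fun z => by
        rw [map_pairTwist hq.torsor.map_smul, hq.comp_eq_mk, hf]) (hpq.comp f.symm)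
    rwa [periodProd_update_pair _ _ _ _ hji, periodProd_update_pair _ _ _ _ hji, neg_neg] at this
  · intro d p q P Q a b a' b' hp hq hpq
    obtain ⟨γ, hinj, h1, h2⟩ := HasPeriods.exists_minElevationDegree_eq (X := X) (Y := Y)
      (A := A) (B := B) hg
    have hord := hpq γ hinj
    rw [h1 p P a b hp, h2 q Q a' b' hq] at hord
    rw [periodProd_single, periodProd_single, ← orderOf_dvd_iff_zpow_eq_one, ← orderOf_dvd_iff_zpow_eq_one, hord]

end Main

end SurfaceCover

theorem mainTheorem3 {S X Y : Type*} [TopologicalSpace S] [TopologicalSpace X] [TopologicalSpace Y]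
    (g : ℕ) (hg : 2 ≤ g) (hS : SurfaceCover.IsClosedOrientableSurface g S)
    (p : X → S) (q : Y → S)
    (hp : SurfaceCover.IsFiniteAbelianCover p) (hq : SurfaceCover.IsFiniteAbelianCover q)
    (h : ∀ γ : C(Circle, S), Function.Injective γ →
      SurfaceCover.minElevationDegree p γ = SurfaceCover.minElevationDegree q γ) :
    SurfaceCover.AreEquivalentCovers p q := by
  obtain ⟨e⟩ := hS
  have := hp.connected
  have := hq.connected
  obtain ⟨A, _, _, _, hpA⟩ := hp.exists_isTorsorCover
  obtain ⟨B, _, _, _, hqB⟩ := hq.exists_isTorsorCover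
  have hpe := hpA.homeomorph_comp e
  have hqe := hqB.homeomorph_comp e
  obtain ⟨P, a, b, hP, hpP⟩ := hpe.exists_isPeriodLift
  obtain ⟨Q, a', b', hQ, hqQ⟩ := hqe.exists_isPeriodLift
  obtain ⟨k, hk⟩ := SurfaceCover.areEquivalentCovers_of_periodProd_eq_one_iff hpe hqe hP hpP hQ hqQ
    fun m n => SurfaceCover.degreesDetermine hg m n _ _ P Q a b a' b' ⟨hpe, hP, hpP⟩ ⟨hqe, hQ, hqQ⟩
      (SurfaceCover.SameDegrees.comp h e)
  exact ⟨k, fun x => e.injective (hk x)⟩
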